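/- \textbf{Conventions.} Signatures are one-sorted first-order signatures with equality, and they share no symbol other than equality when called disjoint. An interpretation of a theory $T$ is a model of $T$ (with non-empty domain) together with values for the variables $x_0,x_1,\dots$. For theories $T_1$, $T_2$ over disjoint signatures $\Sigma_1$, $\Sigma_2$, $T_1\oplus T_2$ is the theory over $\Sigma_1\cup\Sigma_2$ axiomatized by $\mathrm{Ax}(T_1)\cup\mathrm{Ax}(T_2)$. An injective numbering of the function symbols and of the predicate symbols of $\Sigma_1\cup\Sigma_2$ by natural numbers is fixed; formulas over $\Sigma_1$, $\Sigma_2$ and $\Sigma_1\cup\Sigma_2$ are coded by natural numbers accordingly, and decidability of a set of formulas and computability of a function on formulas refer to these codes. A theory $T$ is \emph{decidable} if the set of quantifier-free formulas satisfied by some $T$-interpretation is decidable; \emph{infinitely decidable} if the set of quantifier-free formulas satisfied by some infinite $T$-interpretation is decidable; \emph{smooth} if, whenever a $T$-interpretation $\mathcal A$ satisfies a quantifier-free formula $\varphi$ and $\kappa>|\mathcal A|$ is a cardinal, some $T$-interpretation of cardinality $\kappa$ satisfies $\varphi$. A \emph{minimal model function} of $T$ is a function $\mathrm{minmod}$ from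 the quantifier-free formulas to $\mathbb N\cup\{\aleph_0\}$ such that for every $T$-satisfiable quantifier-free $\varphi$, some $T$-interpretation satisfying $\varphi$ has cardinality $\mathrm{minmod}(\varphi)$ and every $T$-interpretation satisfying $\varphi$ has cardinality at least $\mathrm{minmod}(\varphi)$. \textbf{Theorem.} Let $T_1$ and $T_2$ be decidable theories over disjoint signatures. Suppose that $T_1$ is smooth and has a computable minimal model function, and that $T_2$ is infinitely decidable. Then $T_1\oplus T_2$ is decidable. -/

import Mathlib

open FirstOrder Cardinal

universe u v u' v' u₁ v₁ u₂ v₂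

namespace TheoryCombination

/-- A numbering of the symbols of a signature: distinct function symbols receive distinct numbers,
and so do distinct predicate symbols. -/
structure Numbering (L : FirstOrder.Language.{u, v}) where
  func : (Σ n, L.Functions n) ↪ ℕ
  pred : (Σ n, L.Relations n) ↪ ℕ

/-- The numbering of the symbols of `L₁` that a numbering of `L₁ ∪ L₂` restricts to. -/
def Numbering.left {L₁ : FirstOrder.Language.{u, v}} {L₂ : FirstOrder.Language.{u', v'}}
    (c : Numbering (L₁.sum L₂)) : Numbering L₁ where
  func := ⟨fun f => c.func ⟨f.1, Sum.inl f.2⟩, fun f g h => by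
    obtain ⟨m, f⟩ := f
    obtain ⟨n, g⟩ := g
    have h' := c.func.injective h
    obtain ⟨rfl, h''⟩ := Sigma.mk.inj_iff.1 h'
    exact congrArg (Sigma.mk m) (Sum.inl_injective (eq_of_heq h''))⟩
  pred := ⟨fun r => c.pred ⟨r.1, Sum.inl r.2⟩, fun r s h => by
    obtain ⟨m, r⟩ := r
    obtain ⟨n, s⟩ := s
    have h' := c.pred.injective h
    obtain ⟨rfl, h''⟩ := Sigma.mk.inj_iff.1 h'
    exact congrArg (Sigma.mk m) (Sum.inl_injective (eq_of_heq h''))⟩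

/-- The numbering of the symbols of `L₂` that a numbering of `L₁ ∪ L₂` restricts to. -/
def Numbering.right {L₁ : FirstOrder.Language.{u, v}} {L₂ : FirstOrder.Language.{u', v'}}
    (c : Numbering (L₁.sum L₂)) : Numbering L₂ where
  func := ⟨fun f => c.func ⟨f.1, Sum.inr f.2⟩, fun f g h => by
    obtain ⟨m, f⟩ := f
    obtain ⟨n, g⟩ := g
    have h' := c.func.injective h
    obtain ⟨rfl, h''⟩ := Sigma.mk.inj_iff.1 h'
    exact congrArg (Sigma.mk m) (Sum.inr_injective (eq_of_heq h''))⟩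
  pred := ⟨fun r => c.pred ⟨r.1, Sum.inr r.2⟩, fun r s h => by
    obtain ⟨m, r⟩ := r
    obtain ⟨n, s⟩ := s
    have h' := c.pred.injective h
    obtain ⟨rfl, h''⟩ := Sigma.mk.inj_iff.1 h'
    exact congrArg (Sigma.mk m) (Sum.inr_injective (eq_of_heq h''))⟩

section

variable {L : FirstOrder.Language.{u, v}}

/-- The Gödel number of a term. -/
def termCode (c : Numbering L) {α : Type} [Encodable α] : L.Term α → ℕ
  | .var a => Nat.pair 0 (Encodable.encode a)
  | .func f ts =>
    Nat.pair 1 (Nat.pair (c.func ⟨_, f⟩)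
      (Encodable.encode (List.ofFn fun i => termCode c (ts i))))

/-- The Gödel number of a formula whose free variables are indexed by the natural numbers. -/
def formulaCode (c : Numbering L) : {n : ℕ} → L.BoundedFormula ℕ n → ℕ
  | _, .falsum => Nat.pair 0 0
  | _, .equal s t => Nat.pair 1 (Nat.pair (termCode c s) (termCode c t))
  | _, .rel R ts =>
    Nat.pair 2 (Nat.pair (c.pred ⟨_, R⟩)
      (Encodable.encode (List.ofFn fun i => termCode c (ts i))))
  | _, .imp φ ψ => Nat.pair 3 (Nat.pair (formulaCode c φ) (formulaCode c ψ))
  | _, .all φ => Nat.pair 4 (formulaCode c φ)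

/-- A set `S` of quantifier-free formulas is decidable if the set of the Gödel numbers of its
members is a decidable set of natural numbers. -/
def DecidableSet (c : Numbering L) (S : L.Formula ℕ → Prop) : Prop :=
  ComputablePred fun k : ℕ =>
    ∃ φ : L.Formula ℕ, φ.IsQF ∧ formulaCode c φ = k ∧ S φ

/-- `φ` is satisfied by an interpretation of `T`: a model of `T` with values for the variables. -/
def IsSat (T : L.Theory) (φ : L.Formula ℕ) : Prop :=
  ∃ (M : Type) (_ : L.Structure M) (x : ℕ → M), M ⊨ T ∧ φ.Realize x

/-- `φ` is satisfied by an infinite interpretation of `T`. -/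
def IsInfinitelySat (T : L.Theory) (φ : L.Formula ℕ) : Prop :=
  ∃ (M : Type) (_ : L.Structure M) (x : ℕ → M), Infinite M ∧ M ⊨ T ∧ φ.Realize x

/-- It is decidable whether a quantifier-free formula is satisfiable in `T`. -/
def DecidableTheory (c : Numbering L) (T : L.Theory) : Prop :=
  DecidableSet c (IsSat T)

/-- It is decidable whether a quantifier-free formula is satisfied by an infinite interpretation
of `T`. -/
def InfinitelyDecidable (c : Numbering L) (T : L.Theory) : Prop :=
  DecidableSet c (IsInfinitelySat T)

/-- Satisfying interpretations can be replaced by ones of any larger cardinality. -/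
def Smooth (T : L.Theory) : Prop :=
  ∀ φ : L.Formula ℕ, φ.IsQF →
    ∀ (M : Type) [L.Structure M] (x : ℕ → M), M ⊨ T → φ.Realize x →
      ∀ κ : Cardinal.{0}, #M < κ →
        ∃ (N : Type) (_ : L.Structure N) (y : ℕ → N), N ⊨ T ∧ φ.Realize y ∧ #N = κ

/-- `minmod` gives, for each satisfiable quantifier-free formula, the least cardinality of an
interpretation of `T` that satisfies it; here `⊤` stands for `ℵ₀`. -/
def IsMinimalModelFunction (T : L.Theory) (minmod : L.Formula ℕ → ℕ∞) : Prop :=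
  ∀ φ : L.Formula ℕ, φ.IsQF → IsSat T φ →
    (∃ (M : Type) (_ : L.Structure M) (x : ℕ → M),
      M ⊨ T ∧ φ.Realize x ∧ #M = (minmod φ : Cardinal.{0})) ∧
    ∀ (N : Type) [L.Structure N] (y : ℕ → N),
      N ⊨ T → φ.Realize y → (minmod φ : Cardinal.{0}) ≤ #N

/-- A function from quantifier-free formulas to `ℕ ∪ {ℵ₀}` is computable if some partial recursive
function computes its value at `φ` from the Gödel number of `φ`; here the output `none` stands for
`ℵ₀` and `some k` for `k`. -/
def ComputableOnQF (c : Numbering L) (f : L.Formula ℕ → ℕ∞) : Prop :=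
  ∃ g : ℕ →. Option ℕ, Partrec g ∧
    ∀ φ : L.Formula ℕ, φ.IsQF →
      ∃ o ∈ g (formulaCode c φ), f φ = o.elim ⊤ fun k : ℕ => (k : ℕ∞)

def HasComputableMinimalModelFunction (c : Numbering L) (T : L.Theory) : Prop :=
  ∃ minmod : L.Formula ℕ → ℕ∞, IsMinimalModelFunction T minmod ∧ ComputableOnQF c minmod

end

/-- The theory over `L₁ ∪ L₂` axiomatized by the axioms of `T₁` together with those of `T₂`. -/
def combine {L₁ : FirstOrder.Language.{u, v}} {L₂ : FirstOrder.Language.{u', v'}} (T₁ : L₁.Theory) (T₂ : L₂.Theory) :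
    (L₁.sum L₂).Theory :=
  (FirstOrder.Language.LHom.sumInl : L₁ →ᴸ L₁.sum L₂).onTheory T₁ ∪
    (FirstOrder.Language.LHom.sumInr : L₂ →ᴸ L₁.sum L₂).onTheory T₂

end TheoryCombination

/-! This is a Nelson–Oppen style combination in which Gödel numbers serve as fresh variables. Given
a formula with code `k`, the variable with index `q` stands for the value of the term coded by `q`.
A finite search runs over truth values for all codes below `n = mkEq k k + 1`, stored as the binary
digits of a number `g < 2 ^ n`. Each guess yields one flat formula per signature, its `diagram`: it
evaluates the terms headed by symbols of that signature, fixes the truth values of its atoms, and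
fixes all equations below `n`. Terms headed by a symbol of the other signature behave as variables
there.

If both diagrams hold in models of the two theories of equal cardinality, the equations shared by
the diagrams identify the same codes up to `k`. The matching of values is then a finite partial
bijection; it extends to a bijection, along which the first structure is transported to obtain a
model of the union. Conversely, a model of the union gives its own truth values and its two reducts
(`isSat_combine_iff`).

It remains to decide whether models of equal cardinality exist (`exists_same_card_iff`). By
smoothness, the first diagram holds in models of exactly the cardinalities from its minimal one
upwards. So the second diagram must hold in a model of at least that size: an infinite model if the
minimum is `ℵ₀`, and otherwise a model with `m` distinct elements, which a quantifier-free formula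
in `m` further variables can demand.

Building the diagrams requires deciding which numbers belong to symbols of which arity. This is
extracted from the decidability of the theories themselves (`DecidableTheory.decidableArities`). -/

section Computability

/-! ### Closure properties of computable predicates, and two set-theoretic tools. -/

variable {α β σ : Type*} [Primcodable α] [Primcodable β] [Primcodable σ]

theorem ComputablePred.comp {p : β → Prop} {f : α → β} (hp : ComputablePred p)
    (hf : Computable f) : ComputablePred fun a => p (f a) := by
  classical
  exact (hp.decide.comp hf).computablePred

theorem ComputablePred.and {p q : α → Prop} (hp : ComputablePred p) (hq : ComputablePred q) :
    ComputablePred fun a => p a ∧ q a := by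
  classical
  exact ((Primrec.and.to_comp.comp hp.decide hq.decide).of_eq fun a => by simp).computablePred

theorem ComputablePred.or {p q : α → Prop} (hp : ComputablePred p) (hq : ComputablePred q) :
    ComputablePred fun a => p a ∨ q a := by
  classical
  exact ((Primrec.or.to_comp.comp hp.decide hq.decide).of_eq fun a => by simp).computablePred

theorem ComputablePred.imp {p q : α → Prop} (hp : ComputablePred p) (hq : ComputablePred q) :
    ComputablePred fun a => p a → q a :=
  (hp.not.or hq).of_eq fun _ => imp_iff_not_or.symm

theorem ComputablePred.iff {p q : α → Prop} (hp : ComputablePred p) (hq : ComputablePred q) :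
    ComputablePred fun a => (p a ↔ q a) :=
  ((hp.imp hq).and (hq.imp hp)).of_eq fun _ => iff_iff_implies_and_implies.symm

theorem ComputablePred.const (p : Prop) : ComputablePred fun _ : α => p := by
  classical
  exact (Computable.const (decide p)).computablePred

theorem ComputablePred.eq {f g : α → β} (hf : Computable f) (hg : Computable g) :
    ComputablePred fun a => f a = g a := by
  have h : ComputablePred fun x : β × β => x.1 = x.2 := PrimrecPred.computablePred Primrec.eq
  exact h.comp (hf.pair hg)

theorem Computable.ite {p : α → Prop} [DecidablePred p] {f g : α → σ} (hp : ComputablePred p)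
    (hf : Computable f) (hg : Computable g) : Computable fun a => if p a then f a else g a :=
  (Computable.cond hp.decide hf hg).of_eq fun a => by by_cases h : p a <;> simp [h]

theorem ComputablePred.forall_lt {p : α → ℕ → Prop} {f : α → ℕ} (hf : Computable f)
    (hp : ComputablePred fun x : α × ℕ => p x.1 x.2) :
    ComputablePred fun a => ∀ i < f a, p a i := by
  classical
  have h : Computable fun a => (Nat.rec true
      (fun i b => b && decide (p a i)) (f a) : Bool) :=
    Computable.nat_rec hf (Computable.const true)
      (Primrec.and.to_comp.comp (Computable.snd.comp Computable.snd)
        (hp.decide.comp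
          (Computable.fst.pair (Computable.fst.comp Computable.snd)))).to₂
  refine (h.of_eq fun a => ?_ : Computable fun a => decide (∀ i < f a, p a i)).computablePred
  generalize f a = n
  induction n with
  | zero => simp
  | succ n ih => simp only [ih, Nat.forall_lt_succ_right, Bool.decide_and]

theorem ComputablePred.exists_lt {p : α → ℕ → Prop} {f : α → ℕ} (hf : Computable f)
    (hp : ComputablePred fun x : α × ℕ => p x.1 x.2) :
    ComputablePred fun a => ∃ i < f a, p a i :=
  (ComputablePred.forall_lt (p := fun a i => ¬p a i) hf hp.not).not.of_eq fun a => by simp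

theorem ComputablePred.forall_mem_list [Inhabited β] {p : α → β → Prop} {f : α → List β}
    (hf : Computable f) (hp : ComputablePred fun x : α × β => p x.1 x.2) :
    ComputablePred fun a => ∀ b ∈ f a, p a b := by
  refine (ComputablePred.forall_lt (p := fun a i => p a ((f a).getI i))
    (Primrec.list_length.to_comp.comp hf) (hp.comp (Computable.fst.pair
      (Primrec.list_getI.to_comp.comp (hf.comp Computable.fst) Computable.snd)))).of_eq fun a => ?_
  constructor
  · intro h b hb
    obtain ⟨i, hi, rfl⟩ := List.getElem_of_mem hb
    simpa [List.getI_eq_getElem _ hi] using h i hi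
  · intro h i hi
    rw [List.getI_eq_getElem _ hi]
    exact h _ (List.getElem_mem hi)

/-- Course-of-values recursion for decidable sets of natural numbers. -/
theorem ComputablePred.of_strong_rec {p : ℕ → Prop} {q : List Bool → Prop}
    (hq : ComputablePred q)
    (h : ∀ (n : ℕ) (l : List Bool), l.length = n → (∀ i < n, l.getI i = true ↔ p i) →
      (q l ↔ p n)) : ComputablePred p := by
  classical
  have := Computable.nat_strong_rec (fun (_ : Unit) n => decide (p n))
    (g := fun _ l => some (decide (q l)))
    (Computable.option_some.comp (hq.decide.comp Computable.snd)).to₂ fun _ n => by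
      rw [Option.some_inj, decide_eq_decide]
      refine h n _ (by simp) fun i hi => ?_
      rw [List.getI_eq_getElem _ (by simpa using hi)]
      simp
  exact (this.comp (Computable.const ()) Computable.id).computablePred

theorem Computable.nat_rec_pair {f : α → ℕ} {g : α → σ} {h : α → ℕ → σ → σ} (hf : Computable f)
    (hg : Computable g) (hh : Computable fun x : α × ℕ × σ => h x.1 x.2.1 x.2.2) :
    Computable fun a => (Nat.rec (g a) (h a) (f a) : σ) :=
  Computable.nat_rec (h := fun a x => h a x.1 x.2) hf hg hh

theorem Computable.two_pow {f : α → ℕ} (hf : Computable f) : Computable fun a => 2 ^ f a := by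
  refine (Computable.nat_rec_pair (h := fun _ _ m => m * 2) hf (Computable.const 1)
    (Primrec.nat_mul.to_comp.comp (Computable.snd.comp Computable.snd)
      (Computable.const 2))).of_eq fun a => ?_
  generalize f a = n
  induction n with
  | zero => rfl
  | succ n ih => simp [ih, pow_succ]

theorem ComputablePred.testBit {f g : α → ℕ} (hf : Computable f) (hg : Computable g) :
    ComputablePred fun a => (f a).testBit (g a) = true :=
  (ComputablePred.eq (Primrec.nat_mod.to_comp.comp
    (Primrec.nat_div.to_comp.comp hf hg.two_pow) (Computable.const 2)) (Computable.const 1)).of_eq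
      fun a => by simp [Nat.testBit_eq_decide_div_mod_eq]

/-- Turns the guess of a truth assignment below `n` into a bounded search over numbers. -/
theorem exists_testBit_iff (p : ℕ → Prop) (n : ℕ) :
    ∃ m < 2 ^ n, ∀ i < n, m.testBit i = true ↔ p i := by
  classical
  refine ⟨Nat.ofBits fun i : Fin n => decide (p i), Nat.ofBits_lt_two_pow _, fun i hi => ?_⟩
  rw [Nat.testBit_ofBits_lt _ _ hi]
  simp

theorem exists_strong_rec {M : Type*} [Nonempty M] (F : ℕ → (ℕ → M) → M)
    (hF : ∀ n (x y : ℕ → M), (∀ i < n, x i = y i) → F n x = F n y) :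
    ∃ x : ℕ → M, ∀ n, x n = F n x := by
  classical
  let a : M := Classical.arbitrary M
  -- The values from `n` on are filled with `a`; by `hF` they do not influence `F n`.
  let x : ℕ → M := fun n => Nat.strongRec (fun n ih =>
    F n fun i => if h : i < n then ih i h else a) n
  refine ⟨x, fun n => ?_⟩
  have : x n = F n fun i => if h : i < n then x i else a := by
    simp only [x]
    rw [Nat.strongRec_eq]
  rw [this]
  exact hF _ _ _ fun i hi => by simp [hi]

/-- The hypothesis makes `x i ↦ y i` a well-defined injection on a finite set. It extends to a
bijection because the complements of domain and range are equinumerous: by counting if `M` is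
finite, and because removing finitely many points keeps the cardinality if `M` is infinite. -/
theorem exists_equiv_extending {M N : Type u} (h : #M = #N) (x : ℕ → M) (y : ℕ → N) (n : ℕ)
    (hxy : ∀ i < n, ∀ j < n, (x i = x j ↔ y i = y j)) : ∃ e : M ≃ N, ∀ i < n, e (x i) = y i := by
  classical
  obtain ⟨e₀⟩ := Cardinal.eq.1 h
  let s : Set M := x '' Set.Iio n
  have hs (a : s) : ∃ i < n, x i = a := a.2
  choose i hi hx using hs
  let f : s ↪ N := ⟨fun a => y (i a), fun a b hab => Subtype.ext (by
    rw [← hx a, ← hx b]; exact (hxy _ (hi a) _ (hi b)).2 hab)⟩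
  have hf : ∃ e : M ≃ N, ∀ a : s, e a = f a := by
    cases finite_or_infinite M
    · exact Cardinal.extend_function_finite f ⟨e₀⟩
    · refine Cardinal.extend_function_of_lt f ?_ ⟨e₀⟩
      exact (Cardinal.lt_aleph0_iff_set_finite.2 ((Set.finite_Iio n).image x)).trans_le
        (Cardinal.aleph0_le_mk M)
  obtain ⟨e, he⟩ := hf
  refine ⟨e, fun j hj => ?_⟩
  have := he ⟨x j, j, hj, rfl⟩
  rw [show e (x j) = _ from this]
  exact (hxy _ (hi _) _ hj).1 (hx _)

end Computability

namespace TheoryCombination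

open FirstOrder.Language FirstOrder.Language.Structure

/-! ### Arithmetic of Gödel numbers. -/

section Codes

/-- The code of the variable with a given index. -/
def mkVar (a : ℕ) : ℕ := Nat.pair 0 (2 * a)

/-- The code of the term with a given head symbol and given arguments. -/
def mkFun (i : ℕ) (l : List ℕ) : ℕ := Nat.pair 1 (Nat.pair i (Encodable.encode l))

def mkBot : ℕ := Nat.pair 0 0

def mkEq (s t : ℕ) : ℕ := Nat.pair 1 (Nat.pair s t)

def mkRel (i : ℕ) (l : List ℕ) : ℕ := Nat.pair 2 (Nat.pair i (Encodable.encode l))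

def mkImp (a b : ℕ) : ℕ := Nat.pair 3 (Nat.pair a b)

def mkNot (a : ℕ) : ℕ := mkImp a mkBot

def mkAnd (a b : ℕ) : ℕ := mkNot (mkImp a (mkNot b))

/-- The code of the conjunction of the formulas coded by `h i` for `i < n`. -/
def bigAnd (h : ℕ → ℕ) (n : ℕ) : ℕ := n.rec (mkNot mkBot) fun i a => mkAnd (h i) a

/-- The tag of a code, which tells how the coded object is built. -/
def tag (n : ℕ) : ℕ := n.unpair.1

/-- The first component of a code. -/
def idx (n : ℕ) : ℕ := n.unpair.2.unpair.1

/-- The second component of a code. -/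
def snd (n : ℕ) : ℕ := n.unpair.2.unpair.2

/-- The second component of a code, read as a list. -/
def args (n : ℕ) : List ℕ := Denumerable.ofNat (List ℕ) (snd n)

theorem mem_lt_encode {a : ℕ} {l : List ℕ} (h : a ∈ l) : a < Encodable.encode l := by
  induction l with
  | nil => simp at h
  | cons b l ih =>
    rw [Encodable.encode_list_cons, Nat.lt_succ_iff]
    rcases List.mem_cons.1 h with rfl | h
    · exact Nat.left_le_pair _ _
    · exact (ih h).le.trans (Nat.right_le_pair _ _)

@[simp] theorem tag_mkVar (a : ℕ) : tag (mkVar a) = 0 := by simp [tag, mkVar]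
@[simp] theorem tag_mkFun (i : ℕ) (l : List ℕ) : tag (mkFun i l) = 1 := by simp [tag, mkFun]
@[simp] theorem tag_mkBot : tag mkBot = 0 := by simp [tag, mkBot]
@[simp] theorem tag_mkEq (s t : ℕ) : tag (mkEq s t) = 1 := by simp [tag, mkEq]
@[simp] theorem tag_mkRel (i : ℕ) (l : List ℕ) : tag (mkRel i l) = 2 := by simp [tag, mkRel]
@[simp] theorem tag_mkImp (s t : ℕ) : tag (mkImp s t) = 3 := by simp [tag, mkImp]
@[simp] theorem idx_mkFun (i : ℕ) (l : List ℕ) : idx (mkFun i l) = i := by simp [idx, mkFun]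
@[simp] theorem idx_mkRel (i : ℕ) (l : List ℕ) : idx (mkRel i l) = i := by simp [idx, mkRel]
@[simp] theorem idx_mkEq (s t : ℕ) : idx (mkEq s t) = s := by simp [idx, mkEq]
@[simp] theorem idx_mkImp (s t : ℕ) : idx (mkImp s t) = s := by simp [idx, mkImp]
@[simp] theorem snd_mkEq (s t : ℕ) : snd (mkEq s t) = t := by simp [snd, mkEq]
@[simp] theorem snd_mkImp (s t : ℕ) : snd (mkImp s t) = t := by simp [snd, mkImp]
@[simp] theorem args_mkFun (i : ℕ) (l : List ℕ) : args (mkFun i l) = l := by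
  simp [args, snd, mkFun]
@[simp] theorem args_mkRel (i : ℕ) (l : List ℕ) : args (mkRel i l) = l := by
  simp [args, snd, mkRel]

theorem eq_pair_tag (n : ℕ) : n = Nat.pair (tag n) (Nat.pair (idx n) (snd n)) := by
  simp [tag, idx, snd]

theorem eq_mkFun {n : ℕ} (h : tag n = 1) : n = mkFun (idx n) (args n) := by
  conv_lhs => rw [eq_pair_tag n, h]
  simp [mkFun, args]

theorem eq_mkRel {n : ℕ} (h : tag n = 2) : n = mkRel (idx n) (args n) := by
  conv_lhs => rw [eq_pair_tag n, h]
  simp [mkRel, args]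

theorem eq_mkEq {n : ℕ} (h : tag n = 1) : n = mkEq (idx n) (snd n) := by
  conv_lhs => rw [eq_pair_tag n, h]
  rfl

theorem eq_mkImp {n : ℕ} (h : tag n = 3) : n = mkImp (idx n) (snd n) := by
  conv_lhs => rw [eq_pair_tag n, h]
  rfl

/-- Since `Nat.pair 0 0 = 0`, strictness needs a positive tag. All compound codes have one, so their
parts are strictly smaller, and the recursions on codes rest on this. -/
theorem lt_pair_of_pos {a b c : ℕ} (ha : 0 < a) (h : c ≤ b) : c < Nat.pair a b :=
  h.trans_lt (by
    have := Nat.add_le_pair a b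
    omega)

theorem lt_mkFun {i t : ℕ} {l : List ℕ} (h : t ∈ l) : t < mkFun i l :=
  lt_pair_of_pos one_pos ((mem_lt_encode h).le.trans (Nat.right_le_pair _ _))

theorem lt_mkRel {i t : ℕ} {l : List ℕ} (h : t ∈ l) : t < mkRel i l :=
  lt_pair_of_pos two_pos ((mem_lt_encode h).le.trans (Nat.right_le_pair _ _))

theorem left_lt_mkEq (s t : ℕ) : s < mkEq s t := lt_pair_of_pos one_pos (Nat.left_le_pair _ _)
theorem right_lt_mkEq (s t : ℕ) : t < mkEq s t := lt_pair_of_pos one_pos (Nat.right_le_pair _ _)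
theorem left_lt_mkImp (s t : ℕ) : s < mkImp s t :=
  lt_pair_of_pos (by omega) (Nat.left_le_pair _ _)
theorem right_lt_mkImp (s t : ℕ) : t < mkImp s t :=
  lt_pair_of_pos (by omega) (Nat.right_le_pair _ _)

theorem idx_lt {n : ℕ} (h : tag n = 3) : idx n < n := by
  conv_rhs => rw [eq_mkImp h]
  exact left_lt_mkImp _ _

theorem snd_lt {n : ℕ} (h : tag n = 3) : snd n < n := by
  conv_rhs => rw [eq_mkImp h]
  exact right_lt_mkImp _ _

/-- Bounds all equations between codes up to `n` at once, so that truth values below `mkEq k k + 1`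
settle every equality between codes up to `k`. -/
theorem mkEq_le_mkEq {s t n : ℕ} (hs : s ≤ n) (ht : t ≤ n) : mkEq s t ≤ mkEq n n := by
  have h : ∀ {a b c d : ℕ}, a ≤ c → b ≤ d → Nat.pair a b ≤ Nat.pair c d := fun hac hbd => by
    rcases hac.eq_or_lt with rfl | hac
    · rcases hbd.eq_or_lt with rfl | hbd
      · rfl
      · exact (Nat.pair_lt_pair_right _ hbd).le
    · rcases hbd.eq_or_lt with rfl | hbd
      · exact (Nat.pair_lt_pair_left _ hac).le
      · exact ((Nat.pair_lt_pair_left _ hac).trans (Nat.pair_lt_pair_right _ hbd)).le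
  exact h le_rfl (h hs ht)

variable {α : Type*} [Primcodable α] {f g : α → ℕ}

theorem computable_pair (hf : Computable f) (hg : Computable g) :
    Computable fun a => Nat.pair (f a) (g a) :=
  Primrec₂.natPair.to_comp.comp hf hg

theorem computable_tag (hf : Computable f) : Computable fun a => tag (f a) :=
  Computable.fst.comp (Computable.unpair.comp hf)

theorem computable_idx (hf : Computable f) : Computable fun a => idx (f a) :=
  Computable.fst.comp (Computable.unpair.comp (Computable.snd.comp (Computable.unpair.comp hf)))

theorem computable_snd (hf : Computable f) : Computable fun a => snd (f a) :=
  Computable.snd.comp (Computable.unpair.comp (Computable.snd.comp (Computable.unpair.comp hf)))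

theorem computable_args (hf : Computable f) : Computable fun a => args (f a) := by
  have h : Computable fun n : ℕ => Denumerable.ofNat (List ℕ) n :=
    ((Primrec.option_getD.comp (Primrec.decode (α := List ℕ)) (Primrec.const [])).of_eq
      fun n => by rw [Denumerable.decode_eq_ofNat]; rfl).to_comp
  exact h.comp (computable_snd hf)

theorem computable_mkVar (hf : Computable f) : Computable fun a => mkVar (f a) :=
  computable_pair (Computable.const 0) (Primrec.nat_mul.to_comp.comp (Computable.const 2) hf)

theorem computable_mkFun (hf : Computable f) {l : α → List ℕ} (hl : Computable l) :
    Computable fun a => mkFun (f a) (l a) :=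
  computable_pair (Computable.const 1) (computable_pair hf (Computable.encode.comp hl))

theorem computable_mkRel (hf : Computable f) {l : α → List ℕ} (hl : Computable l) :
    Computable fun a => mkRel (f a) (l a) :=
  computable_pair (Computable.const 2) (computable_pair hf (Computable.encode.comp hl))

theorem computable_mkEq (hf : Computable f) (hg : Computable g) :
    Computable fun a => mkEq (f a) (g a) :=
  computable_pair (Computable.const 1) (computable_pair hf hg)

theorem computable_mkImp (hf : Computable f) (hg : Computable g) :
    Computable fun a => mkImp (f a) (g a) :=
  computable_pair (Computable.const 3) (computable_pair hf hg)

theorem computable_mkNot (hf : Computable f) : Computable fun a => mkNot (f a) :=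
  computable_mkImp hf (Computable.const mkBot)

theorem computable_mkAnd (hf : Computable f) (hg : Computable g) :
    Computable fun a => mkAnd (f a) (g a) :=
  computable_mkNot (computable_mkImp hf (computable_mkNot hg))

theorem computable_bigAnd {h : α → ℕ → ℕ} (hf : Computable f)
    (hh : Computable fun x : α × ℕ => h x.1 x.2) : Computable fun a => bigAnd (h a) (f a) :=
  Computable.nat_rec_pair (h := fun a i b => mkAnd (h a i) b) hf (Computable.const _)
    (computable_mkAnd (hh.comp (Computable.fst.pair (Computable.fst.comp Computable.snd)))
      (Computable.snd.comp Computable.snd))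

theorem computable_map_mkVar {l : α → List ℕ} (hl : Computable l) :
    Computable fun a => (l a).map mkVar := by
  have h : Primrec fun l : List ℕ => l.map mkVar :=
    Primrec.list_map Primrec.id (Primrec₂.natPair.comp (Primrec.const 0)
      (Primrec.nat_mul.comp (Primrec.const 2) Primrec.snd)).to₂
  exact h.to_comp.comp hl

end Codes

/-! ### Recognizing the codes of terms and of quantifier-free formulas. -/

section Formulas

variable {L : FirstOrder.Language.{u, v}} (c : Numbering L)

/-- The number `i` belongs to a function symbol of arity `n`. -/
def Numbering.IsFunc (i n : ℕ) : Prop := ∃ f : L.Functions n, c.func ⟨n, f⟩ = i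

/-- The number `i` belongs to a predicate symbol of arity `n`. -/
def Numbering.IsPred (i n : ℕ) : Prop := ∃ R : L.Relations n, c.pred ⟨n, R⟩ = i

/-- The number `k` is the code of a term over the variables. -/
def IsTermCode (k : ℕ) : Prop := ∃ t : L.Term (ℕ ⊕ Fin 0), termCode c t = k

/-- The number `k` is the code of a quantifier-free formula with the property `S`. -/
def HasCode (S : L.Formula ℕ → Prop) (k : ℕ) : Prop :=
  ∃ φ : L.Formula ℕ, φ.IsQF ∧ formulaCode c φ = k ∧ S φ

theorem termCode_inl (a : ℕ) {n : ℕ} :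
    termCode c (Term.var (Sum.inl a) : L.Term (ℕ ⊕ Fin n)) = mkVar a := by
  simp [termCode, mkVar, Encodable.encode_inl]

theorem termCode_func {α : Type} [Encodable α] {n : ℕ} (f : L.Functions n)
    (ts : Fin n → L.Term α) :
    termCode c (Term.func f ts) = mkFun (c.func ⟨n, f⟩) (List.ofFn fun i => termCode c (ts i)) :=
  rfl

theorem formulaCode_falsum {n : ℕ} :
    formulaCode c (BoundedFormula.falsum : L.BoundedFormula ℕ n) = mkBot := rfl

theorem formulaCode_equal {n : ℕ} (s t : L.Term (ℕ ⊕ Fin n)) :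
    formulaCode c (BoundedFormula.equal s t) = mkEq (termCode c s) (termCode c t) := rfl

theorem formulaCode_rel {n m : ℕ} (R : L.Relations m) (ts : Fin m → L.Term (ℕ ⊕ Fin n)) :
    formulaCode c (BoundedFormula.rel R ts) =
      mkRel (c.pred ⟨m, R⟩) (List.ofFn fun i => termCode c (ts i)) := rfl

theorem formulaCode_imp {n : ℕ} (φ ψ : L.BoundedFormula ℕ n) :
    formulaCode c (φ.imp ψ) = mkImp (formulaCode c φ) (formulaCode c ψ) := rfl

theorem mkFun_inj {i j : ℕ} {l l' : List ℕ} : mkFun i l = mkFun j l' ↔ i = j ∧ l = l' := by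
  simp [mkFun, Nat.pair_eq_pair]

theorem mkRel_inj {i j : ℕ} {l l' : List ℕ} : mkRel i l = mkRel j l' ↔ i = j ∧ l = l' := by
  simp [mkRel, Nat.pair_eq_pair]

theorem mkEq_inj {s t s' t' : ℕ} : mkEq s t = mkEq s' t' ↔ s = s' ∧ t = t' := by
  simp [mkEq, Nat.pair_eq_pair]

theorem mkImp_inj {s t s' t' : ℕ} : mkImp s t = mkImp s' t' ↔ s = s' ∧ t = t' := by
  simp [mkImp, Nat.pair_eq_pair]

theorem termCode_injective {α : Type} [Encodable α] :
    Function.Injective (termCode c : L.Term α → ℕ) := by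
  intro s
  induction s with
  | var a =>
    intro t h
    cases t with
    | var b => simpa [termCode, Nat.pair_eq_pair] using h
    | func f ts => simp [termCode, Nat.pair_eq_pair] at h
  | func f ts ih =>
    intro t h
    cases t with
    | var b => simp [termCode, Nat.pair_eq_pair] at h
    | func g us =>
      rw [termCode_func, termCode_func, mkFun_inj] at h
      obtain ⟨h₁, h₂⟩ := h
      obtain ⟨rfl, h₃⟩ := Sigma.mk.inj_iff.1 (c.func.injective h₁)
      obtain rfl := eq_of_heq h₃
      congr 1
      funext i
      exact ih i (congrFun (List.ofFn_injective h₂) i)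

/-- The numbering is injective on symbols together with their arities, so a code determines its head
symbol and its number of arguments. Hence whether a code lies in a decidable set depends only on the
formula it codes. -/
theorem formulaCode_injective {n : ℕ} :
    Function.Injective (formulaCode c : L.BoundedFormula ℕ n → ℕ) := by
  intro φ
  induction φ with
  | falsum => intro ψ h; cases ψ <;> simp [formulaCode, Nat.pair_eq_pair] at h ⊢
  | equal s t =>
    intro ψ h
    cases ψ with
    | equal s' t' =>
      rw [formulaCode_equal, formulaCode_equal, mkEq_inj] at h
      rw [termCode_injective c h.1, termCode_injective c h.2]
    | _ => simp [formulaCode, Nat.pair_eq_pair] at h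
  | rel R ts =>
    intro ψ h
    cases ψ with
    | rel R' us =>
      rw [formulaCode_rel, formulaCode_rel, mkRel_inj] at h
      obtain ⟨h₁, h₂⟩ := h
      obtain ⟨rfl, h₃⟩ := Sigma.mk.inj_iff.1 (c.pred.injective h₁)
      obtain rfl := eq_of_heq h₃
      congr 1
      funext i
      exact termCode_injective c (congrFun (List.ofFn_injective h₂) i)
    | _ => simp [formulaCode, Nat.pair_eq_pair] at h
  | imp φ₁ φ₂ ih₁ ih₂ =>
    intro ψ h
    cases ψ with
    | imp ψ₁ ψ₂ =>
      rw [formulaCode_imp, formulaCode_imp, mkImp_inj] at h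
      rw [ih₁ h.1, ih₂ h.2]
    | _ => simp [formulaCode, Nat.pair_eq_pair] at h
  | all φ ih =>
    intro ψ h
    cases ψ with
    | all ψ =>
      simp only [formulaCode, Nat.pair_eq_pair, true_and] at h
      rw [ih h]
    | _ => simp [formulaCode, Nat.pair_eq_pair] at h

theorem hasCode_formulaCode {S : L.Formula ℕ → Prop} {φ : L.Formula ℕ} (hφ : φ.IsQF) :
    HasCode c S (formulaCode c φ) ↔ S φ :=
  ⟨fun ⟨_, _, h, hS⟩ => formulaCode_injective c h ▸ hS, fun h => ⟨φ, hφ, rfl, h⟩⟩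

theorem isTermCode_mkVar (a : ℕ) : IsTermCode c (mkVar a) :=
  ⟨Term.var (Sum.inl a), termCode_inl c a⟩

theorem isTermCode_mkFun {i : ℕ} {l : List ℕ} :
    IsTermCode c (mkFun i l) ↔ c.IsFunc i l.length ∧ ∀ t ∈ l, IsTermCode c t := by
  constructor
  · rintro ⟨t, ht⟩
    cases t with
    | var a => simp [termCode, mkFun, Nat.pair_eq_pair] at ht
    | func f ts =>
      rw [termCode_func, mkFun_inj] at ht
      obtain ⟨rfl, rfl⟩ := ht
      refine ⟨by rw [List.length_ofFn]; exact ⟨f, rfl⟩, ?_⟩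
      simp only [List.mem_ofFn]
      rintro _ ⟨i, rfl⟩
      exact ⟨_, rfl⟩
  · rintro ⟨⟨f, rfl⟩, h⟩
    choose t ht using fun i : Fin l.length => h (l.get i) (List.get_mem l i)
    exact ⟨Term.func f t, by rw [termCode_func]; simp only [ht, List.ofFn_get]⟩

/-- The right-hand side refers to strictly smaller codes only, which suits course-of-values
recursion. The parity condition reflects that `Sum.inl a` is encoded as `2 * a`. -/
theorem isTermCode_iff (k : ℕ) : IsTermCode c k ↔
    (tag k = 0 ∧ k.unpair.2 % 2 = 0) ∨
      (tag k = 1 ∧ c.IsFunc (idx k) (args k).length ∧ ∀ t ∈ args k, IsTermCode c t) := by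
  constructor
  · rintro ⟨t, rfl⟩
    cases t with
    | var a =>
      rcases a with a | a
      · left
        rw [termCode_inl]
        simp [mkVar, tag]
      · exact a.elim0
    | func f ts =>
      right
      refine ⟨by simp [termCode_func], ?_⟩
      have := (isTermCode_mkFun c (i := c.func ⟨_, f⟩)
        (l := List.ofFn fun i => termCode c (ts i))).1 ⟨Term.func f ts, rfl⟩
      simpa [termCode_func] using this
  · rintro (⟨h₁, h₂⟩ | ⟨h₁, h₂⟩)
    · have : k = mkVar (k.unpair.2 / 2) := by
        rw [mkVar, Nat.mul_div_cancel' (Nat.dvd_of_mod_eq_zero h₂), ← h₁, tag, Nat.pair_unpair]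
      rw [this]
      exact isTermCode_mkVar c _
    · rw [eq_mkFun h₁]
      exact (isTermCode_mkFun c).2 h₂

/-- The number `k` is the code of a quantifier-free formula. -/
def IsQFCode (k : ℕ) : Prop := HasCode c (fun _ => True) k

theorem isPred_of_formulaCode {φ : L.Formula ℕ} {i : ℕ} {l : List ℕ}
    (h : formulaCode c φ = mkRel i l) : c.IsPred i l.length ∧ ∀ t ∈ l, IsTermCode c t := by
  cases φ with
  | rel R ts =>
    rw [formulaCode_rel, mkRel_inj] at h
    obtain ⟨rfl, rfl⟩ := h
    refine ⟨by rw [List.length_ofFn]; exact ⟨R, rfl⟩, ?_⟩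
    simp only [List.mem_ofFn]
    rintro _ ⟨i, rfl⟩
    exact ⟨_, rfl⟩
  | _ => simp [formulaCode, mkRel, Nat.pair_eq_pair] at h

/-- As for terms, the recursion descends to smaller codes. The first case is `k = mkBot` and not
`tag k = 0`, because other codes with tag `0` are not formulas. -/
theorem isQFCode_iff (k : ℕ) : IsQFCode c k ↔
    k = mkBot ∨ (tag k = 1 ∧ IsTermCode c (idx k) ∧ IsTermCode c (snd k)) ∨
      (tag k = 2 ∧ c.IsPred (idx k) (args k).length ∧ ∀ t ∈ args k, IsTermCode c t) ∨
      (tag k = 3 ∧ IsQFCode c (idx k) ∧ IsQFCode c (snd k)) := by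
  constructor
  · rintro ⟨φ, hφ, rfl, -⟩
    cases hφ with
    | falsum => exact Or.inl rfl
    | of_isAtomic h =>
      cases h with
      | equal s t =>
        refine Or.inr (Or.inl ?_)
        rw [show formulaCode c (s.bdEqual t) = _ from formulaCode_equal c s t]
        simp [IsTermCode]
      | rel R ts =>
        refine Or.inr (Or.inr (Or.inl ?_))
        have h : formulaCode c (R.boundedFormula ts) = _ := formulaCode_rel c R ts
        have := isPred_of_formulaCode c h
        rw [h]
        simpa using this
    | imp h₁ h₂ =>
      refine Or.inr (Or.inr (Or.inr ?_))
      rw [formulaCode_imp]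
      simp only [tag_mkImp, idx_mkImp, snd_mkImp, true_and]
      exact ⟨⟨_, h₁, rfl, trivial⟩, ⟨_, h₂, rfl, trivial⟩⟩
  · rintro (rfl | ⟨h, ⟨s, hs⟩, t, ht⟩ | ⟨h, ⟨R, hR⟩, h'⟩ | ⟨h, ⟨φ, hφ, hφk, -⟩, ψ, hψ, hψk, -⟩)
    · exact ⟨_, .falsum, rfl, trivial⟩
    · refine ⟨_, (BoundedFormula.IsAtomic.equal s t).isQF, ?_, trivial⟩
      rw [eq_mkEq h, ← hs, ← ht]
      rfl
    · choose t ht using fun i : Fin (args k).length => h' ((args k).get i) (List.get_mem _ i)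
      refine ⟨_, (BoundedFormula.IsAtomic.rel R t).isQF, ?_, trivial⟩
      refine (formulaCode_rel c R t).trans ?_
      rw [hR]
      simp only [ht, List.ofFn_get]
      exact (eq_mkRel h).symm
    · refine ⟨_, hφ.imp hψ, ?_, trivial⟩
      rw [formulaCode_imp, hφk, hψk]
      exact (eq_mkImp h).symm

/-- The arities of the symbols can be computed from their numbers. -/
structure Numbering.DecidableArities : Prop where
  func : ComputablePred fun x : ℕ × ℕ => c.IsFunc x.1 x.2
  pred : ComputablePred fun x : ℕ × ℕ => c.IsPred x.1 x.2

variable {c}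

theorem args_lt {k t : ℕ} (hk : tag k = 1) (h : t ∈ args k) : t < k := by
  rw [eq_mkFun hk]
  exact lt_mkFun h

theorem computablePred_isTermCode (hc : c.DecidableArities) : ComputablePred (IsTermCode c) := by
  have hlen : Computable fun l : List Bool => l.length := Primrec.list_length.to_comp
  refine ComputablePred.of_strong_rec (q := fun l => (tag l.length = 0 ∧
    l.length.unpair.2 % 2 = 0) ∨ (tag l.length = 1 ∧ c.IsFunc (idx l.length) (args l.length).length
      ∧ ∀ t ∈ args l.length, l.getI t = true)) ?_ ?_
  · refine ComputablePred.or (ComputablePred.and (ComputablePred.eq (computable_tag hlen)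
      (Computable.const _)) (ComputablePred.eq (Primrec.nat_mod.to_comp.comp
        (Computable.snd.comp (Computable.unpair.comp hlen)) (Computable.const 2))
          (Computable.const _))) (ComputablePred.and (ComputablePred.eq (computable_tag hlen)
            (Computable.const _)) (ComputablePred.and ?_ ?_))
    · exact hc.func.comp ((computable_idx hlen).pair
        (Primrec.list_length.to_comp.comp (computable_args hlen)))
    · exact ComputablePred.forall_mem_list (p := fun (l : List Bool) t => l.getI t = true)
        (computable_args hlen) (ComputablePred.eq (Primrec.list_getI.to_comp.comp
          Computable.fst Computable.snd) (Computable.const true))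
  · rintro n l rfl h
    rw [isTermCode_iff]
    refine or_congr_right (and_congr_right fun h₁ => and_congr_right fun _ => ?_)
    exact forall₂_congr fun t ht => h t (args_lt h₁ ht)

theorem computablePred_isQFCode (hc : c.DecidableArities) : ComputablePred (IsQFCode c) := by
  have hlen : Computable fun l : List Bool => l.length := Primrec.list_length.to_comp
  have htag (i : ℕ) : ComputablePred fun l : List Bool => tag l.length = i :=
    ComputablePred.eq (computable_tag hlen) (Computable.const _)
  have hterm := computablePred_isTermCode hc
  have hget {f : List Bool → ℕ} (hf : Computable f) :
      ComputablePred fun l : List Bool => l.getI (f l) = true :=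
    ComputablePred.eq (Primrec.list_getI.to_comp.comp Computable.id hf) (Computable.const true)
  refine ComputablePred.of_strong_rec (q := fun l => l.length = mkBot ∨
    (tag l.length = 1 ∧ IsTermCode c (idx l.length) ∧ IsTermCode c (snd l.length)) ∨
    (tag l.length = 2 ∧ c.IsPred (idx l.length) (args l.length).length ∧
      ∀ t ∈ args l.length, IsTermCode c t) ∨
    (tag l.length = 3 ∧ l.getI (idx l.length) = true ∧ l.getI (snd l.length) = true)) ?_ ?_
  · refine ComputablePred.or (ComputablePred.eq hlen (Computable.const _)) (ComputablePred.or
      ((htag 1).and ((hterm.comp (computable_idx hlen)).and (hterm.comp (computable_snd hlen))))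
      (ComputablePred.or ((htag 2).and (ComputablePred.and ?_ ?_)) ((htag 3).and
        ((hget (computable_idx hlen)).and (hget (computable_snd hlen))))))
    · exact hc.pred.comp ((computable_idx hlen).pair
        (Primrec.list_length.to_comp.comp (computable_args hlen)))
    · exact ComputablePred.forall_mem_list (p := fun (_ : List Bool) t => IsTermCode c t)
        (computable_args hlen) (hterm.comp Computable.snd)
  · rintro n l rfl h
    rw [isQFCode_iff]
    refine or_congr_right (or_congr_right (or_congr_right (and_congr_right fun h₁ => ?_)))
    rw [h _ (idx_lt h₁), h _ (snd_lt h₁)]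

end Formulas

/-! ### Codes of formulas described by their meaning, and arities from decidability. -/

section Representation

variable {L : FirstOrder.Language.{u, v}} {c : Numbering L}

/-- The number `k` is the code of a quantifier-free formula that expresses `C`. -/
def Represents (c : Numbering L) (k : ℕ) (C : ∀ (M : Type) [L.Structure M], (ℕ → M) → Prop) :
    Prop :=
  ∃ φ : L.Formula ℕ, φ.IsQF ∧ formulaCode c φ = k ∧
    ∀ (M : Type) [L.Structure M] (x : ℕ → M), φ.Realize x ↔ C M x

namespace Represents

variable {C D : ∀ (M : Type) [L.Structure M], (ℕ → M) → Prop} {a b : ℕ}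

theorem congr (h : Represents c a C)
    (hCD : ∀ (M : Type) [L.Structure M] (x : ℕ → M), C M x ↔ D M x) : Represents c a D := by
  obtain ⟨φ, hφ, hk, h⟩ := h
  exact ⟨φ, hφ, hk, fun M _ x => (h M x).trans (hCD M x)⟩

theorem bot : Represents c mkBot fun _ _ _ => False :=
  ⟨⊥, BoundedFormula.isQF_bot, rfl, fun _ _ _ => Iff.rfl⟩

theorem imp (ha : Represents c a C) (hb : Represents c b D) :
    Represents c (mkImp a b) fun M _ x => C M x → D M x := by
  obtain ⟨φ, hφ, rfl, h⟩ := ha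
  obtain ⟨ψ, hψ, rfl, h'⟩ := hb
  refine ⟨φ.imp ψ, hφ.imp hψ, rfl, fun M _ x => ?_⟩
  rw [Formula.realize_imp, h, h']

theorem not (ha : Represents c a C) : Represents c (mkNot a) fun M _ x => ¬C M x :=
  ha.imp bot

theorem and (ha : Represents c a C) (hb : Represents c b D) :
    Represents c (mkAnd a b) fun M _ x => C M x ∧ D M x :=
  (ha.imp hb.not).not.congr fun _ _ _ => by simp

theorem top : Represents c (mkNot mkBot) fun _ _ _ => True :=
  bot.not.congr fun _ _ _ => by simp

theorem bigAnd {h : ℕ → ℕ} {C : ℕ → ∀ (M : Type) [L.Structure M], (ℕ → M) → Prop} {n : ℕ}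
    (hh : ∀ i < n, Represents c (h i) (C i)) :
    Represents c (bigAnd h n) fun M _ x => ∀ i < n, C i M x := by
  induction n with
  | zero => exact top.congr fun _ _ _ => by simp
  | succ n ih =>
    exact ((hh n n.lt_succ_self).and (ih fun i hi => hh i (hi.trans n.lt_succ_self))).congr
      fun M _ x => by simp only [Nat.forall_lt_succ_right, and_comm]

theorem var_eq_var (s t : ℕ) :
    Represents c (mkEq (mkVar s) (mkVar t)) fun _ _ x => x s = x t :=
  ⟨_, (BoundedFormula.IsAtomic.equal (.var (.inl s)) (.var (.inl t))).isQF, by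
    rw [← termCode_inl c, ← termCode_inl c]; rfl, fun _ _ _ => Iff.rfl⟩

theorem var_eq_func (s : ℕ) {n : ℕ} (f : L.Functions n) (ts : Fin n → ℕ) :
    Represents c (mkEq (mkVar s) (mkFun (c.func ⟨n, f⟩) ((List.ofFn ts).map mkVar)))
      fun _ _ x => x s = funMap f (x ∘ ts) :=
  ⟨_, (BoundedFormula.IsAtomic.equal (.var (.inl s)) (.func f fun i => .var (.inl (ts i)))).isQF, by
    refine (formulaCode_equal c _ _).trans ?_
    rw [termCode_inl, termCode_func, List.map_ofFn]
    simp only [termCode_inl]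
    rfl, fun _ _ _ => Iff.rfl⟩

theorem rel {n : ℕ} (R : L.Relations n) (ts : Fin n → ℕ) :
    Represents c (mkRel (c.pred ⟨n, R⟩) ((List.ofFn ts).map mkVar))
      fun _ _ x => RelMap R (x ∘ ts) :=
  ⟨_, (BoundedFormula.IsAtomic.rel R fun i => .var (.inl (ts i))).isQF, by
    refine (formulaCode_rel c _ _).trans ?_
    rw [List.map_ofFn]
    simp only [termCode_inl]
    rfl, fun _ _ _ => Iff.rfl⟩

theorem hasCode_isSat (h : Represents c a C) (T : L.Theory) : HasCode c (IsSat T) a ↔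
    ∃ (M : Type) (_ : L.Structure M) (x : ℕ → M), M ⊨ T ∧ C M x := by
  obtain ⟨φ, hφ, rfl, h⟩ := h
  rw [hasCode_formulaCode c hφ]
  simp only [IsSat, h]

theorem hasCode_isInfinitelySat (h : Represents c a C) (T : L.Theory) :
    HasCode c (IsInfinitelySat T) a ↔
      ∃ (M : Type) (_ : L.Structure M) (x : ℕ → M), Infinite M ∧ M ⊨ T ∧ C M x := by
  obtain ⟨φ, hφ, rfl, h⟩ := h
  rw [hasCode_formulaCode c hφ]
  simp only [IsInfinitelySat, h]

end Represents

theorem HasCode.isQFCode {S : L.Formula ℕ → Prop} {k : ℕ} (h : HasCode c S k) : IsQFCode c k :=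
  let ⟨φ, hφ, hk, _⟩ := h
  ⟨φ, hφ, hk, trivial⟩

theorem isQFCode_mkImp {a b : ℕ} :
    IsQFCode c (mkImp a b) ↔ IsQFCode c a ∧ IsQFCode c b := by
  rw [isQFCode_iff]
  have h : mkImp a b ≠ mkBot := by simp [mkImp, mkBot, Nat.pair_eq_pair]
  simp [h]

theorem isQFCode_mkEq {s t : ℕ} :
    IsQFCode c (mkEq s t) ↔ IsTermCode c s ∧ IsTermCode c t := by
  rw [isQFCode_iff]
  have h : mkEq s t ≠ mkBot := by simp [mkEq, mkBot, Nat.pair_eq_pair]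
  simp [h]

theorem isQFCode_mkRel {i : ℕ} {l : List ℕ} :
    IsQFCode c (mkRel i l) ↔ c.IsPred i l.length ∧ ∀ t ∈ l, IsTermCode c t := by
  rw [isQFCode_iff]
  have h : mkRel i l ≠ mkBot := by simp [mkRel, mkBot, Nat.pair_eq_pair]
  simp [h]

theorem replicate_mkVar (n : ℕ) :
    List.replicate n (mkVar 0) = (List.ofFn fun _ : Fin n => 0).map mkVar := by
  simp

/-- A self-implication between equations with a term `t` is satisfiable if and only if it is a
formula, that is, if and only if `t` is a term. -/
theorem isFunc_iff {T : L.Theory}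
    (hT : ∃ (M : Type) (_ : L.Structure M), Nonempty M ∧ M ⊨ T) (i n : ℕ) :
    c.IsFunc i n ↔ HasCode c (IsSat T) (mkImp
      (mkEq (mkVar 0) (mkFun i (List.replicate n (mkVar 0))))
      (mkEq (mkVar 0) (mkFun i (List.replicate n (mkVar 0))))) := by
  obtain ⟨M, _, ⟨m⟩, hM⟩ := hT
  constructor
  · rintro ⟨f, rfl⟩
    rw [replicate_mkVar]
    have h := Represents.var_eq_func (c := c) 0 f fun _ => 0
    exact ((h.imp h).hasCode_isSat T).2 ⟨M, _, fun _ => m, hM, id⟩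
  · intro h
    have h₁ := h.isQFCode
    rw [isQFCode_mkImp, isQFCode_mkEq, isTermCode_mkFun, List.length_replicate] at h₁
    exact h₁.1.2.1

theorem isPred_iff {T : L.Theory}
    (hT : ∃ (M : Type) (_ : L.Structure M), Nonempty M ∧ M ⊨ T) (i n : ℕ) :
    c.IsPred i n ↔ HasCode c (IsSat T) (mkImp (mkRel i (List.replicate n (mkVar 0)))
      (mkRel i (List.replicate n (mkVar 0)))) := by
  obtain ⟨M, _, ⟨m⟩, hM⟩ := hT
  constructor
  · rintro ⟨R, rfl⟩
    rw [replicate_mkVar]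
    have h := Represents.rel (c := c) R fun _ => 0
    exact ((h.imp h).hasCode_isSat T).2 ⟨M, _, fun _ => m, hM, id⟩
  · intro h
    have h₁ := h.isQFCode
    rw [isQFCode_mkImp, isQFCode_mkRel, List.length_replicate] at h₁
    exact h₁.1.1

/-- In a theory with a non-empty model, satisfiability of a tautology `p → p` is a purely syntactic
test of whether `p` is a formula. The decision procedure thus reveals the signature. -/
theorem DecidableTheory.decidableArities {T : L.Theory} (h : DecidableTheory c T)
    (hT : ∃ (M : Type) (_ : L.Structure M), Nonempty M ∧ M ⊨ T) : c.DecidableArities := by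
  have h' : ComputablePred (HasCode c (IsSat T)) := h
  have hl : Computable fun x : ℕ × ℕ => List.replicate x.2 (mkVar 0) :=
    ((Primrec.list_map (Primrec.list_range.comp Primrec.snd)
      (Primrec.const (mkVar 0)).to₂).of_eq fun x => by simp).to_comp
  constructor
  · refine (h'.comp ?_).of_eq fun x => (isFunc_iff hT x.1 x.2).symm
    have := computable_mkEq (Computable.const (mkVar 0)) (computable_mkFun Computable.fst hl)
    exact computable_mkImp this this
  · refine (h'.comp ?_).of_eq fun x => (isPred_iff hT x.1 x.2).symm
    have := computable_mkRel Computable.fst hl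
    exact computable_mkImp this this

end Representation

/-! ### Arities in the union of two signatures. -/

section Sum

variable {L₁ : FirstOrder.Language.{u₁, v₁}} {L₂ : FirstOrder.Language.{u₂, v₂}}
  {c : Numbering (L₁.sum L₂)}

theorem isFunc_sum (i n : ℕ) : c.IsFunc i n ↔ c.left.IsFunc i n ∨ c.right.IsFunc i n := by
  constructor
  · rintro ⟨f | f, h⟩
    · exact Or.inl ⟨f, h⟩
    · exact Or.inr ⟨f, h⟩
  · rintro (⟨f, h⟩ | ⟨f, h⟩)
    · exact ⟨Sum.inl f, h⟩
    · exact ⟨Sum.inr f, h⟩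

theorem isPred_sum (i n : ℕ) : c.IsPred i n ↔ c.left.IsPred i n ∨ c.right.IsPred i n := by
  constructor
  · rintro ⟨R | R, h⟩
    · exact Or.inl ⟨R, h⟩
    · exact Or.inr ⟨R, h⟩
  · rintro (⟨R, h⟩ | ⟨R, h⟩)
    · exact ⟨Sum.inl R, h⟩
    · exact ⟨Sum.inr R, h⟩

theorem Numbering.DecidableArities.sum (h₁ : c.left.DecidableArities)
    (h₂ : c.right.DecidableArities) : c.DecidableArities :=
  ⟨(h₁.func.or h₂.func).of_eq fun x => (isFunc_sum x.1 x.2).symm,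
    (h₁.pred.or h₂.pred).of_eq fun x => (isPred_sum x.1 x.2).symm⟩

end Sum

/-! ### Flat diagrams in variables indexed by codes. -/

section Diagram

variable {L : FirstOrder.Language.{u, v}} (c : Numbering L)

/-- In the structure `M`, where `x s` is the value of the code `s` as a term and `b s` its truth
value as a formula, the codes below `n` of flat terms and of atomic formulas are evaluated
correctly. -/
structure Compatible (b : ℕ → Prop) (n : ℕ) (M : Type) [L.Structure M] (x : ℕ → M) : Prop where
  func : ∀ {m : ℕ} (f : L.Functions m) (ts : Fin m → ℕ),
    mkFun (c.func ⟨m, f⟩) (List.ofFn ts) < n →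
      x (mkFun (c.func ⟨m, f⟩) (List.ofFn ts)) = funMap f (x ∘ ts)
  rel : ∀ {m : ℕ} (R : L.Relations m) (ts : Fin m → ℕ),
    mkRel (c.pred ⟨m, R⟩) (List.ofFn ts) < n →
      (RelMap R (x ∘ ts) ↔ b (mkRel (c.pred ⟨m, R⟩) (List.ofFn ts)))
  eq : ∀ s t : ℕ, mkEq s t < n → (x s = x t ↔ b (mkEq s t))

/-- The truth values `b` respect the propositional connectives in the codes below `n`. -/
def RespectsConnectives (b : ℕ → Prop) (n : ℕ) : Prop :=
  ∀ q < n, (tag q = 0 → ¬b q) ∧ (tag q = 3 → (b q ↔ (b (idx q) → b (snd q))))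

variable {c} {b : ℕ → Prop} {n : ℕ} {M : Type} [L.Structure M] {x : ℕ → M}

theorem funMap_eq_of_mkFun_eq {k m : ℕ} {f : L.Functions k} {g : L.Functions m} {ts : Fin k → ℕ}
    {us : Fin m → ℕ} (h : mkFun (c.func ⟨k, f⟩) (List.ofFn ts) =
      mkFun (c.func ⟨m, g⟩) (List.ofFn us)) (x : ℕ → M) :
    funMap f (x ∘ ts) = funMap g (x ∘ us) := by
  obtain ⟨h₁, h₂⟩ := mkFun_inj.1 h
  obtain ⟨rfl, h₃⟩ := Sigma.mk.inj_iff.1 (c.func.injective h₁)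
  rw [eq_of_heq h₃, List.ofFn_injective h₂]

theorem relMap_iff_of_mkRel_eq {k m : ℕ} {R : L.Relations k} {S : L.Relations m} {ts : Fin k → ℕ}
    {us : Fin m → ℕ} (h : mkRel (c.pred ⟨k, R⟩) (List.ofFn ts) =
      mkRel (c.pred ⟨m, S⟩) (List.ofFn us)) (x : ℕ → M) :
    RelMap R (x ∘ ts) ↔ RelMap S (x ∘ us) := by
  obtain ⟨h₁, h₂⟩ := mkRel_inj.1 h
  obtain ⟨rfl, h₃⟩ := Sigma.mk.inj_iff.1 (c.pred.injective h₁)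
  rw [eq_of_heq h₃, List.ofFn_injective h₂]

theorem Numbering.IsFunc.exists_eq_mkFun {q : ℕ} (hq : tag q = 1)
    (h : c.IsFunc (idx q) (args q).length) :
    ∃ (m : ℕ) (f : L.Functions m) (ts : Fin m → ℕ), q = mkFun (c.func ⟨m, f⟩) (List.ofFn ts) := by
  obtain ⟨f, hf⟩ := h
  exact ⟨_, f, (args q).get, by rw [hf, List.ofFn_get]; exact eq_mkFun hq⟩

theorem Numbering.IsPred.exists_eq_mkRel {q : ℕ} (hq : tag q = 2)
    (h : c.IsPred (idx q) (args q).length) :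
    ∃ (m : ℕ) (R : L.Relations m) (ts : Fin m → ℕ), q = mkRel (c.pred ⟨m, R⟩) (List.ofFn ts) := by
  obtain ⟨R, hR⟩ := h
  exact ⟨_, R, (args q).get, by rw [hR, List.ofFn_get]; exact eq_mkRel hq⟩

theorem Compatible.mono {m : ℕ} (h : Compatible c b n M x) (hm : m ≤ n) : Compatible c b m M x :=
  ⟨fun f ts hlt => h.func f ts (hlt.trans_le hm), fun R ts hlt => h.rel R ts (hlt.trans_le hm),
    fun s t hlt => h.eq s t (hlt.trans_le hm)⟩

/-- Compatibility depends only on the values of the codes below `n`. -/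
theorem Compatible.congr {y : ℕ → M} {b' : ℕ → Prop} (h : Compatible c b n M x)
    (hxy : ∀ i < n, x i = y i) (hb : ∀ i < n, b i ↔ b' i) : Compatible c b' n M y := by
  refine ⟨fun f ts hlt => ?_, fun R ts hlt => ?_, fun s t hlt => ?_⟩
  · rw [← hxy _ hlt, h.func f ts hlt]
    congr 1
    funext i
    exact hxy _ ((lt_mkFun (List.mem_ofFn.2 ⟨i, rfl⟩)).trans hlt)
  · rw [← hb _ hlt, ← h.rel R ts hlt]
    have : x ∘ ts = y ∘ ts := by
      funext i
      exact hxy _ ((lt_mkRel (List.mem_ofFn.2 ⟨i, rfl⟩)).trans hlt)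
    rw [this]
  · rw [← hb _ hlt, ← h.eq s t hlt, hxy _ ((left_lt_mkEq s t).trans hlt),
      hxy _ ((right_lt_mkEq s t).trans hlt)]

theorem RespectsConnectives.mono {m : ℕ} (h : RespectsConnectives b n) (hm : m ≤ n) :
    RespectsConnectives b m := fun q hq => h q (hq.trans_le hm)

theorem RespectsConnectives.congr {b' : ℕ → Prop} (h : RespectsConnectives b n)
    (hb : ∀ i < n, b i ↔ b' i) : RespectsConnectives b' n := by
  refine fun q hq => ⟨fun ht => by rw [← hb _ hq]; exact (h q hq).1 ht, fun ht => ?_⟩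
  rw [← hb _ hq, (h q hq).2 ht, hb _ ((idx_lt ht).trans hq), hb _ ((snd_lt ht).trans hq)]

theorem Compatible.realize_term (h : Compatible c b n M x) (y : Fin 0 → M)
    (t : L.Term (ℕ ⊕ Fin 0)) (ht : termCode c t < n) :
    t.realize (Sum.elim (fun a => x (mkVar a)) y) = x (termCode c t) := by
  induction t with
  | var a =>
    rcases a with a | a
    · rw [termCode_inl]
      rfl
    · exact a.elim0
  | func f ts ih =>
    rw [termCode_func] at ht ⊢
    rw [h.func f _ ht, Term.realize_func]
    congr 1
    funext i
    exact ih i ((lt_mkFun (List.mem_ofFn.2 ⟨i, rfl⟩)).trans ht)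

/-- Links the guessed truth values to semantics. The induction stays below `n` because parts have
smaller codes. A number may code both a term and a formula; `x` and `b` treat the two readings
separately. -/
theorem Compatible.realize_formula (h : Compatible c b n M x) (hb : RespectsConnectives b n)
    {φ : L.Formula ℕ} (hφ : φ.IsQF) (hn : formulaCode c φ < n) :
    φ.Realize (fun a => x (mkVar a)) ↔ b (formulaCode c φ) := by
  induction hφ with
  | falsum =>
    rw [formulaCode_falsum] at hn ⊢
    exact iff_of_false id ((hb _ hn).1 tag_mkBot)
  | of_isAtomic hφ =>
    cases hφ with
    | equal s t =>
      have hst : formulaCode c (s.bdEqual t) = _ := formulaCode_equal c s t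
      rw [hst] at hn ⊢
      rw [← h.eq _ _ hn, Formula.Realize, BoundedFormula.realize_bdEqual,
        h.realize_term _ _ ((left_lt_mkEq _ _).trans hn),
        h.realize_term _ _ ((right_lt_mkEq _ _).trans hn)]
    | rel R ts =>
      have hR : formulaCode c (R.boundedFormula ts) = _ := formulaCode_rel c R ts
      rw [hR] at hn ⊢
      rw [← h.rel R _ hn, Formula.Realize, BoundedFormula.realize_rel]
      have : (fun i => (ts i).realize (Sum.elim (fun a => x (mkVar a)) default)) =
          x ∘ fun i => termCode c (ts i) := by
        funext i
        exact h.realize_term _ _ ((lt_mkRel (List.mem_ofFn.2 ⟨i, rfl⟩)).trans hn)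
      rw [this]
  | imp _ _ ih₁ ih₂ =>
    rw [formulaCode_imp] at hn ⊢
    rw [(hb _ hn).2 (tag_mkImp _ _), idx_mkImp, snd_mkImp,
      ← ih₁ ((left_lt_mkImp _ _).trans hn), ← ih₂ ((right_lt_mkImp _ _).trans hn),
      Formula.realize_imp]

/-- Every valuation of the variables extends to values and truth values for all codes. -/
theorem exists_compatible (c : Numbering L) (v : ℕ → M) :
    ∃ (x : ℕ → M) (b : ℕ → Prop), (∀ a, x (mkVar a) = v a) ∧ ∀ n, Compatible c b n M x ∧
      RespectsConnectives b n := by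
  classical
  have : Nonempty M := ⟨v 0⟩
  -- The graph of evaluating `q` from the values of its arguments; injectivity of the numbering
  -- makes it single-valued, as `hR` records.
  let R (q : ℕ) (x : ℕ → M) (m : M) : Prop := ∃ (k : ℕ) (f : L.Functions k) (ts : Fin k → ℕ),
    q = mkFun (c.func ⟨k, f⟩) (List.ofFn ts) ∧ m = funMap f (x ∘ ts)
  have hR (q x m m') (h : R q x m) (h' : R q x m') : m = m' := by
    obtain ⟨k, f, ts, rfl, rfl⟩ := h
    obtain ⟨k', f', ts', h, rfl⟩ := h'
    exact funMap_eq_of_mkFun_eq h x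
  -- The default returns `v a` at `mkVar a = Nat.pair 0 (2 * a)`; at the other codes outside the
  -- graph its value is irrelevant.
  obtain ⟨x, hx⟩ := exists_strong_rec
    (fun q x => if h : ∃ m, R q x m then h.choose else v (q.unpair.2 / 2)) (by
      intro n x y hxy
      have : R n x = R n y := by
        funext m
        refine propext (exists_congr fun k => exists_congr fun f => exists_congr fun ts =>
          and_congr_right fun hn => ?_)
        have : x ∘ ts = y ∘ ts := by
          funext i
          refine hxy _ ?_
          rw [hn]
          exact lt_mkFun (List.mem_ofFn.2 ⟨i, rfl⟩)
        rw [this]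
      simp only [this])
  -- Codes that are neither equations, relational atoms nor implications get the value false, as
  -- `RespectsConnectives` demands for tag `0`.
  obtain ⟨b, hb⟩ := exists_strong_rec (M := Prop) (fun q b =>
    (tag q = 1 ∧ x (idx q) = x (snd q)) ∨ (∃ (k : ℕ) (P : L.Relations k) (ts : Fin k → ℕ),
      q = mkRel (c.pred ⟨k, P⟩) (List.ofFn ts) ∧ RelMap P (x ∘ ts)) ∨
      (tag q = 3 ∧ (b (idx q) → b (snd q)))) (by
      intro n b b' h
      refine propext (or_congr_right (or_congr_right (and_congr_right fun hn => ?_)))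
      rw [h _ (idx_lt hn), h _ (snd_lt hn)])
  refine ⟨x, b, fun a => ?_, fun n => ⟨⟨fun f ts _ => ?_, fun P ts _ => ?_, fun s t _ => ?_⟩,
    fun q _ => ⟨fun hq => ?_, fun hq => ?_⟩⟩⟩
  · rw [hx, dif_neg]
    · simp [mkVar]
    · rintro ⟨m, k, f, ts, h, -⟩
      simpa using congrArg tag h
  · have h : ∃ m, R (mkFun (c.func ⟨_, f⟩) (List.ofFn ts)) x m := ⟨_, _, f, ts, rfl, rfl⟩
    rw [hx, dif_pos h]
    exact hR _ _ _ _ h.choose_spec ⟨_, f, ts, rfl, rfl⟩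
  · rw [hb]
    simp only [tag_mkRel, OfNat.ofNat_ne_one, false_and, Nat.reduceEqDiff, or_false, false_or]
    refine ⟨fun h => ⟨_, P, ts, rfl, h⟩, ?_⟩
    rintro ⟨k, P', ts', h, hP⟩
    exact (relMap_iff_of_mkRel_eq h x).2 hP
  · rw [hb]
    simp only [tag_mkEq, idx_mkEq, snd_mkEq, true_and, OfNat.one_ne_ofNat, false_and, or_false]
    refine (or_iff_left ?_).symm
    rintro ⟨k, P', ts', h, -⟩
    simpa using congrArg tag h
  · rw [hb]
    rintro (⟨h, -⟩ | ⟨k, P', ts', rfl, -⟩ | ⟨h, -⟩)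
    · omega
    · simp at hq
    · omega
  · conv_lhs => rw [hb]
    constructor
    · rintro (⟨h, -⟩ | ⟨k, P', ts', rfl, -⟩ | ⟨-, h⟩)
      · omega
      · simp at hq
      · exact h
    · exact fun h => Or.inr (Or.inr ⟨hq, h⟩)

open Classical in
/-- The code of the equation which says that the value of the term code `q` is computed from the
values of its arguments; a tautology if `q` is not such a code. -/
noncomputable def funcLiteral (c : Numbering L) (q : ℕ) : ℕ :=
  if tag q = 1 ∧ c.IsFunc (idx q) (args q).length then
    mkEq (mkVar q) (mkFun (idx q) ((args q).map mkVar))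
  else mkNot mkBot

open Classical in
/-- The code of the literal which says that the atomic formula with code `q` has the truth value
`b`; a tautology if `q` is not such a code. -/
noncomputable def atomLiteral (c : Numbering L) (b : Prop) [Decidable b] (q : ℕ) : ℕ :=
  if tag q = 1 then
    if b then mkEq (mkVar (idx q)) (mkVar (snd q)) else mkNot (mkEq (mkVar (idx q)) (mkVar (snd q)))
  else if tag q = 2 ∧ c.IsPred (idx q) (args q).length then
    if b then mkRel (idx q) ((args q).map mkVar) else mkNot (mkRel (idx q) ((args q).map mkVar))
  else mkNot mkBot

/-- The code of a formula that describes compatibility, for truth values given by the binary digits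
of `g`. -/
noncomputable def diagram (c : Numbering L) (g n : ℕ) : ℕ :=
  bigAnd (fun q => mkAnd (funcLiteral c q) (atomLiteral c (g.testBit q) q)) n

/-- All decompositions of `q` give the same value by injectivity of the numbering, so a single
equation expresses the quantified condition; if there is none, the condition is vacuous. -/
theorem represents_funcLiteral (c : Numbering L) (q : ℕ) :
    Represents c (funcLiteral c q) fun _ _ x => ∀ (m : ℕ) (f : L.Functions m) (ts : Fin m → ℕ),
      q = mkFun (c.func ⟨m, f⟩) (List.ofFn ts) → x q = funMap f (x ∘ ts) := by
  rw [funcLiteral]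
  split_ifs with h
  · obtain ⟨m, f, ts, rfl⟩ := h.2.exists_eq_mkFun h.1
    rw [idx_mkFun, args_mkFun]
    refine (Represents.var_eq_func _ f ts).congr fun M _ x => ⟨fun h m' f' ts' hm => ?_,
      fun h => h m f ts rfl⟩
    exact h.trans (funMap_eq_of_mkFun_eq hm x)
  · refine Represents.top.congr fun M _ x => iff_of_true trivial ?_
    rintro m f ts rfl
    refine (h ⟨by simp, ?_⟩).elim
    simp only [idx_mkFun, args_mkFun, List.length_ofFn]
    exact ⟨f, rfl⟩

theorem represents_atomLiteral (c : Numbering L) (b : Prop) [Decidable b] (q : ℕ) :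
    Represents c (atomLiteral c b q) fun _ _ x =>
      (∀ (m : ℕ) (R : L.Relations m) (ts : Fin m → ℕ),
        q = mkRel (c.pred ⟨m, R⟩) (List.ofFn ts) → (RelMap R (x ∘ ts) ↔ b)) ∧
      ∀ s t, q = mkEq s t → (x s = x t ↔ b) := by
  have hsign {a : ℕ} {C : ∀ (M : Type) [L.Structure M], (ℕ → M) → Prop} (h : Represents c a C)
      : Represents c (if b then a else mkNot a) fun M _ x => (C M x ↔ b) := by
    split_ifs with hb
    · exact h.congr fun _ _ _ => by simp [hb]
    · exact h.not.congr fun _ _ _ => by simp [hb]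
  rw [atomLiteral]
  by_cases h₁ : tag q = 1
  · rw [if_pos h₁]
    refine (hsign (.var_eq_var _ _)).congr fun M _ x => ⟨fun h => ⟨?_, ?_⟩,
      fun h => h.2 _ _ (eq_mkEq h₁)⟩
    · rintro m R ts rfl
      simp at h₁
    · rintro s t rfl
      simpa using h
  · rw [if_neg h₁]
    by_cases h₂ : tag q = 2 ∧ c.IsPred (idx q) (args q).length
    · rw [if_pos h₂]
      obtain ⟨m, R, ts, rfl⟩ := h₂.2.exists_eq_mkRel h₂.1
      rw [idx_mkRel, args_mkRel]
      refine (hsign (.rel R ts)).congr fun M _ x => ⟨fun h => ⟨fun m' R' ts' hm =>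
        (relMap_iff_of_mkRel_eq hm x).symm.trans h, fun s t hst => ?_⟩, fun h => h.1 m R ts rfl⟩
      simpa using congrArg tag hst
    · rw [if_neg h₂]
      refine Represents.top.congr fun M _ x => iff_of_true trivial ⟨?_, ?_⟩
      · rintro m R ts rfl
        refine (h₂ ⟨by simp, ?_⟩).elim
        simp only [idx_mkRel, args_mkRel, List.length_ofFn]
        exact ⟨R, rfl⟩
      · rintro s t rfl
        simp at h₁

theorem represents_diagram (c : Numbering L) (g n : ℕ) :
    Represents c (diagram c g n) fun M _ x => Compatible c (fun q => g.testBit q = true) n M x :=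
  (Represents.bigAnd fun q _ => (represents_funcLiteral c q).and
    (represents_atomLiteral c (g.testBit q = true) q)).congr fun M _ x =>
      ⟨fun h => ⟨fun f ts hq => (h _ hq).1 _ f ts rfl, fun R ts hq => (h _ hq).2.1 _ R ts rfl,
        fun s t hq => (h _ hq).2.2 s t rfl⟩,
      fun h q hq => ⟨by rintro m f ts rfl; exact h.func f ts hq,
        by rintro m R ts rfl; exact h.rel R ts hq, by rintro s t rfl; exact h.eq s t hq⟩⟩

theorem computable_diagram (hc : c.DecidableArities) {α : Type*} [Primcodable α] {g n : α → ℕ}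
    (hg : Computable g) (hn : Computable n) : Computable fun a => diagram c (g a) (n a) := by
  classical
  have hq : Computable fun x : α × ℕ => x.2 := Computable.snd
  have hl : Computable fun x : α × ℕ => (args x.2).length :=
    Primrec.list_length.to_comp.comp (computable_args hq)
  have htag (i : ℕ) : ComputablePred fun x : α × ℕ => tag x.2 = i :=
    ComputablePred.eq (computable_tag hq) (Computable.const i)
  have hbit : ComputablePred fun x : α × ℕ => (g x.1).testBit x.2 = true :=
    ComputablePred.testBit (hg.comp Computable.fst) hq
  have hmap := computable_map_mkVar (computable_args hq)
  have htop : Computable fun _ : α × ℕ => mkNot mkBot := Computable.const _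
  have heq := computable_mkEq (computable_mkVar (computable_idx hq))
    (computable_mkVar (computable_snd hq))
  have hrel := computable_mkRel (computable_idx hq) hmap
  refine computable_bigAnd (h := fun a q => mkAnd (funcLiteral c q)
    (atomLiteral c ((g a).testBit q) q)) hn (computable_mkAnd ?_ ?_)
  · exact Computable.ite ((htag 1).and (hc.func.comp ((computable_idx hq).pair hl)))
      (computable_mkEq (computable_mkVar hq) (computable_mkFun (computable_idx hq) hmap)) htop
  · exact Computable.ite (htag 1) (Computable.ite hbit heq (computable_mkNot heq))
      (Computable.ite ((htag 2).and (hc.pred.comp ((computable_idx hq).pair hl)))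
        (Computable.ite hbit hrel (computable_mkNot hrel)) htop)

theorem computablePred_respectsConnectives {α : Type*} [Primcodable α] {g n : α → ℕ}
    (hg : Computable g) (hn : Computable n) :
    ComputablePred fun a => RespectsConnectives (fun q => (g a).testBit q = true) (n a) := by
  have hq : Computable fun x : α × ℕ => x.2 := Computable.snd
  have htag (i : ℕ) : ComputablePred fun x : α × ℕ => tag x.2 = i :=
    ComputablePred.eq (computable_tag hq) (Computable.const i)
  have hbit {f : α × ℕ → ℕ} (hf : Computable f) :
      ComputablePred fun x : α × ℕ => (g x.1).testBit (f x) = true :=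
    ComputablePred.testBit (hg.comp Computable.fst) hf
  exact ComputablePred.forall_lt (p := fun a q => (tag q = 0 → ¬(g a).testBit q = true) ∧
    (tag q = 3 → ((g a).testBit q = true ↔ ((g a).testBit (idx q) = true →
      (g a).testBit (snd q) = true)))) hn
    (((htag 0).imp (hbit hq).not).and ((htag 3).imp
      ((hbit hq).iff ((hbit (computable_idx hq)).imp (hbit (computable_snd hq))))))

end Diagram

variable {L₁ : FirstOrder.Language.{u₁, v₁}} {L₂ : FirstOrder.Language.{u₂, v₂}}

/-! ### Matching the cardinalities of models. -/

section Matching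

/-- The code of a formula which says that the variables with the indices `k, …, k + m - 1` have
distinct values. -/
def mkDistinct (k m : ℕ) : ℕ :=
  bigAnd (fun i => bigAnd (fun j => mkNot (mkEq (mkVar (k + i)) (mkVar (k + j)))) i) m

theorem represents_mkDistinct (c : Numbering L₁) (k m : ℕ) :
    Represents c (mkDistinct k m) fun _ _ x => ∀ i < m, ∀ j < i, x (k + i) ≠ x (k + j) :=
  .bigAnd fun _ _ => .bigAnd fun _ _ => (Represents.var_eq_var _ _).not

theorem computable_mkDistinct {α : Type*} [Primcodable α] {k m : α → ℕ}
    (hk : Computable k) (hm : Computable m) : Computable fun a => mkDistinct (k a) (m a) := by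
  refine computable_bigAnd (h := fun a i => bigAnd (fun j => mkNot (mkEq (mkVar (k a + i))
    (mkVar (k a + j)))) i) hm (computable_bigAnd (h := fun (x : α × ℕ) j =>
      mkNot (mkEq (mkVar (k x.1 + x.2)) (mkVar (k x.1 + j)))) Computable.snd
        (computable_mkNot (computable_mkEq (computable_mkVar ?_) (computable_mkVar ?_))))
  · exact Primrec.nat_add.to_comp.comp (hk.comp (Computable.fst.comp Computable.fst))
      (Computable.snd.comp Computable.fst)
  · exact Primrec.nat_add.to_comp.comp (hk.comp (Computable.fst.comp Computable.fst))
      Computable.snd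

theorem natCast_le_mk_of_distinct {M : Type} {x : ℕ → M} {k m : ℕ}
    (h : ∀ i < m, ∀ j < i, x (k + i) ≠ x (k + j)) : (m : Cardinal.{0}) ≤ #M := by
  rw [← Cardinal.mk_fin]
  refine Cardinal.mk_le_of_injective (f := fun i : Fin m => x (k + i)) fun i j hij => ?_
  by_contra hne
  rcases lt_or_gt_of_ne hne with hlt | hlt
  · exact h j j.2 i hlt hij.symm
  · exact h i i.2 j hlt hij

/-- The variables below `k` keep their values, so a property that reads only these survives the
change. -/
theorem exists_distinct_of_natCast_le_mk {M : Type} (x : ℕ → M) (k : ℕ) {m : ℕ}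
    (h : (m : Cardinal.{0}) ≤ #M) :
    ∃ y : ℕ → M, (∀ i < k, x i = y i) ∧ ∀ i < m, ∀ j < i, y (k + i) ≠ y (k + j) := by
  rw [← Cardinal.mk_fin, Cardinal.le_def] at h
  obtain ⟨e⟩ := h
  refine ⟨fun i => if h : k ≤ i ∧ i - k < m then e ⟨i - k, h.2⟩ else x i, fun i hi => ?_,
    fun i hi j hj => ?_⟩
  · dsimp only
    rw [dif_neg (by omega)]
  · have hj' := hj.trans hi
    simp [hi, hj', hj.ne']

/-- Models of equal cardinality exist if and only if the second theory has a model which is large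
enough for the first one. -/
theorem exists_same_card_iff {c₁ : Numbering L₁} {c₂ : Numbering L₂} {T₁ : L₁.Theory}
    {T₂ : L₂.Theory} (hsmooth : Smooth T₁) {minmod : L₁.Formula ℕ → ℕ∞}
    (hmin : IsMinimalModelFunction T₁ minmod) {h : ℕ → Option ℕ}
    (hh : ∀ φ : L₁.Formula ℕ, φ.IsQF → IsSat T₁ φ →
      minmod φ = (h (formulaCode c₁ φ)).elim ⊤ fun k : ℕ => (k : ℕ∞))
    {a₁ a₂ n : ℕ} {C₁ : ∀ (M : Type) [L₁.Structure M], (ℕ → M) → Prop}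
    {C₂ : ∀ (M : Type) [L₂.Structure M], (ℕ → M) → Prop}
    (h₁ : Represents c₁ a₁ C₁) (h₂ : Represents c₂ a₂ C₂)
    (hC₂ : ∀ (M : Type) [L₂.Structure M] (x y : ℕ → M), (∀ i < n, x i = y i) →
      C₂ M x → C₂ M y) :
    (∃ (M N : Type) (_ : L₁.Structure M) (_ : L₂.Structure N) (x : ℕ → M) (y : ℕ → N),
      #M = #N ∧ M ⊨ T₁ ∧ N ⊨ T₂ ∧ C₁ M x ∧ C₂ N y) ↔
    HasCode c₁ (IsSat T₁) a₁ ∧ ((h a₁ = none ∧ HasCode c₂ (IsInfinitelySat T₂) a₂) ∨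
      (h a₁ ≠ none ∧
        HasCode c₂ (IsSat T₂) (mkAnd a₂ (mkDistinct n ((h a₁).getD 0))))) := by
  -- The cardinality of the first model is eliminated: once `a₁` is satisfiable, its models realize
  -- exactly the cardinalities from the minimal one upwards.
  have key : HasCode c₁ (IsSat T₁) a₁ →
      ((∃ (M N : Type) (_ : L₁.Structure M) (_ : L₂.Structure N) (x : ℕ → M) (y : ℕ → N),
        #M = #N ∧ M ⊨ T₁ ∧ N ⊨ T₂ ∧ C₁ M x ∧ C₂ N y) ↔
      ∃ (N : Type) (_ : L₂.Structure N) (y : ℕ → N), N ⊨ T₂ ∧ C₂ N y ∧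
        (((h a₁).elim ⊤ fun k : ℕ => (k : ℕ∞) : ℕ∞) : Cardinal.{0}) ≤ #N) := by
    intro hsat
    obtain ⟨φ, hφ, rfl, hC₁⟩ := h₁
    rw [hasCode_formulaCode c₁ hφ] at hsat
    obtain ⟨⟨M₀, _, x₀, hM₀, hx₀, hcard⟩, hle⟩ := hmin φ hφ hsat
    rw [← hh φ hφ hsat]
    constructor
    · rintro ⟨M, N, _, _, x, y, hMN, hM, hN, hx, hy⟩
      exact ⟨N, _, y, hN, hy, hMN ▸ hle M x hM ((hC₁ M x).2 hx)⟩
    · rintro ⟨N, _, y, hN, hy, hcard'⟩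
      -- Smoothness covers strictly larger cardinalities; at equality the minimal model itself
      -- serves.
      rcases hcard'.eq_or_lt with heq | hlt
      · exact ⟨M₀, N, _, _, x₀, y, hcard.trans heq, hM₀, hN, (hC₁ M₀ x₀).1 hx₀, hy⟩
      · obtain ⟨M, _, x, hM, hx, hMN⟩ := hsmooth φ hφ M₀ x₀ hM₀ hx₀ #N (hcard ▸ hlt)
        exact ⟨M, N, _, _, x, y, hMN, hM, hN, (hC₁ M x).1 hx, hy⟩
  have hsat : (∃ (M N : Type) (_ : L₁.Structure M) (_ : L₂.Structure N) (x : ℕ → M) (y : ℕ → N),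
      #M = #N ∧ M ⊨ T₁ ∧ N ⊨ T₂ ∧ C₁ M x ∧ C₂ N y) → HasCode c₁ (IsSat T₁) a₁ := by
    rintro ⟨M, N, _, _, x, y, -, hM, -, hx, -⟩
    exact (h₁.hasCode_isSat T₁).2 ⟨M, _, x, hM, hx⟩
  rw [← and_iff_right_of_imp hsat]
  refine and_congr_right fun hs => (key hs).trans ?_
  rw [h₂.hasCode_isInfinitelySat, (h₂.and (represents_mkDistinct c₂ n _)).hasCode_isSat]
  cases h a₁ with
  | none =>
    simp only [Option.elim_none, Cardinal.ofENat_top, true_and, ne_eq, not_true_eq_false,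
      false_and, or_false, Cardinal.infinite_iff]
    exact exists_congr fun N => exists_congr fun _ => exists_congr fun y => by tauto
  | some m =>
    simp only [Option.elim_some, Cardinal.ofENat_nat, reduceCtorEq, false_and, ne_eq,
      not_false_eq_true, true_and, false_or, Option.getD_some]
    constructor
    · rintro ⟨N, _, y, hN, hy, hm⟩
      -- The witnesses of size occupy the variables from `n` on, which `C₂` does not read.
      obtain ⟨z, hyz, hz⟩ := exists_distinct_of_natCast_le_mk y n hm
      exact ⟨N, _, z, hN, hC₂ N y z hyz hy, hz⟩
    · rintro ⟨N, _, y, hN, hy, hz⟩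
      exact ⟨N, _, y, hN, hy, natCast_le_mk_of_distinct hz⟩

end Matching

/-! ### Gluing the two models, and the decision procedure. -/

section Combination

variable {c : Numbering (L₁.sum L₂)} {T₁ : L₁.Theory} {T₂ : L₂.Theory}

theorem model_combine_iff {M : Type} [L₁.Structure M] [L₂.Structure M] [(L₁.sum L₂).Structure M]
    [(LHom.sumInl : L₁ →ᴸ L₁.sum L₂).IsExpansionOn M]
    [(LHom.sumInr : L₂ →ᴸ L₁.sum L₂).IsExpansionOn M] :
    M ⊨ combine T₁ T₂ ↔ M ⊨ T₁ ∧ M ⊨ T₂ := by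
  rw [combine, Theory.model_union_iff, LHom.onTheory_model, LHom.onTheory_model]

/-- Every symbol of the union comes from one side, and both sides share the clause on equations.
This purifies a mixed formula without rewriting it. -/
theorem compatible_sum_iff {b : ℕ → Prop} {n : ℕ} {M : Type} {x : ℕ → M} [L₁.Structure M]
    [L₂.Structure M] [(L₁.sum L₂).Structure M]
    [(LHom.sumInl : L₁ →ᴸ L₁.sum L₂).IsExpansionOn M]
    [(LHom.sumInr : L₂ →ᴸ L₁.sum L₂).IsExpansionOn M] :
    Compatible c b n M x ↔ Compatible c.left b n M x ∧ Compatible c.right b n M x := by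
  constructor
  · refine fun h => ⟨⟨fun f ts hn => ?_, fun R ts hn => ?_, h.eq⟩,
      ⟨fun f ts hn => ?_, fun R ts hn => ?_, h.eq⟩⟩
    · exact (h.func (Sum.inl f) ts hn).trans (LHom.map_onFunction LHom.sumInl f _)
    · exact (Iff.of_eq (LHom.map_onRelation LHom.sumInl R _)).symm.trans
        (h.rel (Sum.inl R) ts hn)
    · exact (h.func (Sum.inr f) ts hn).trans (LHom.map_onFunction LHom.sumInr f _)
    · exact (Iff.of_eq (LHom.map_onRelation LHom.sumInr R _)).symm.trans
        (h.rel (Sum.inr R) ts hn)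
  · rintro ⟨h₁, h₂⟩
    refine ⟨fun {m} f ts hn => ?_, fun {m} R ts hn => ?_, h₁.eq⟩
    · rcases f with f | f
      · exact (h₁.func f ts hn).trans (LHom.map_onFunction LHom.sumInl f _).symm
      · exact (h₂.func f ts hn).trans (LHom.map_onFunction LHom.sumInr f _).symm
    · rcases R with R | R
      · exact (Iff.of_eq (LHom.map_onRelation LHom.sumInl R _)).trans (h₁.rel R ts hn)
      · exact (Iff.of_eq (LHom.map_onRelation LHom.sumInr R _)).trans (h₂.rel R ts hn)

/-- Compatibility is transported along bijections. -/
theorem Compatible.induced {L : FirstOrder.Language.{u, v}} {c : Numbering L} {b : ℕ → Prop}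
    {n : ℕ} {M N : Type} [L.Structure M] {x : ℕ → M} (h : Compatible c b n M x) (e : M ≃ N) :
    letI : L.Structure N := e.inducedStructure
    Compatible c b n N (e ∘ x) := by
  let S : L.Structure N := e.inducedStructure
  refine @Compatible.mk L c b n N S (e ∘ x) (fun f ts hn => ?_) (fun R ts hn => ?_)
    fun s t hn => ?_
  · exact (congrArg e (h.func f ts hn)).trans
      ((e.inducedStructureEquiv (L := L)).map_fun f (x ∘ ts))
  · rw [← h.rel R ts hn]
    exact (e.inducedStructureEquiv (L := L)).map_rel R (x ∘ ts)
  · rw [← h.eq s t hn]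
    exact e.apply_eq_iff_eq

/-- One direction reads the digits of `g` off a model and takes its reducts. For the other, both
diagrams prescribe the same equalities among codes up to `k`, so the two models can be glued along a
bijection; digit `k` then says that `φ` holds. -/
theorem isSat_combine_iff (c : Numbering (L₁.sum L₂)) (T₁ : L₁.Theory) (T₂ : L₂.Theory)
    {φ : (L₁.sum L₂).Formula ℕ} (hφ : φ.IsQF) {k n : ℕ} (hk : formulaCode c φ = k)
    (hn : mkEq k k < n) :
    IsSat (combine T₁ T₂) φ ↔ ∃ g < 2 ^ n, RespectsConnectives (fun q => g.testBit q = true) n ∧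
      g.testBit k = true ∧
      ∃ (M N : Type) (_ : L₁.Structure M) (_ : L₂.Structure N) (x : ℕ → M) (y : ℕ → N),
        #M = #N ∧ M ⊨ T₁ ∧ N ⊨ T₂ ∧ Compatible c.left (fun q => g.testBit q = true) n M x ∧
          Compatible c.right (fun q => g.testBit q = true) n N y := by
  have hkn : k < n := (left_lt_mkEq k k).trans hn
  subst hk
  constructor
  · rintro ⟨M, _, v, hM, hv⟩
    obtain ⟨x, b, hxv, hxb⟩ := exists_compatible c v
    obtain ⟨g, hg, hgb⟩ := exists_testBit_iff b n
    have hgb' := fun i hi => (hgb i hi).symm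
    let := (LHom.sumInl : L₁ →ᴸ L₁.sum L₂).reduct M
    let := (LHom.sumInr : L₂ →ᴸ L₁.sum L₂).reduct M
    have hT := model_combine_iff.1 hM
    have hC := compatible_sum_iff.1 ((hxb n).1.congr (fun _ _ => rfl) hgb')
    refine ⟨g, hg, (hxb n).2.congr hgb', (hgb _ hkn).2 ?_, M, M, _, _, x, x, rfl, hT.1, hT.2,
      hC.1, hC.2⟩
    rw [← (hxb n).1.realize_formula (hxb n).2 hφ hkn]
    simpa only [hxv] using hv
  · rintro ⟨g, -, hg, hgk, M, N, _, _, x, y, hMN, hM, hN, hx, hy⟩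
    obtain ⟨e, he⟩ := exists_equiv_extending hMN x y (formulaCode c φ + 1) fun i hi j hj => by
      have hij := (mkEq_le_mkEq (Nat.lt_succ_iff.1 hi) (Nat.lt_succ_iff.1 hj)).trans_lt hn
      rw [hx.eq i j hij, hy.eq i j hij]
    let : L₁.Structure N := e.inducedStructure
    have hN₁ : N ⊨ T₁ := StrongHomClass.theory_model (e.inducedStructureEquiv (L := L₁))
    -- The bijection matches values only for codes up to `k`, so compatibility is cut down from `n`
    -- to `k + 1`, which still covers `φ`.
    have hx' := ((hx.induced e).mono hkn).congr he fun _ _ => Iff.rfl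
    have hC := compatible_sum_iff.2 ⟨hx', hy.mono hkn⟩
    refine ⟨N, inferInstance, fun a => y (mkVar a), model_combine_iff.2 ⟨hN₁, hN⟩, ?_⟩
    exact (hC.realize_formula (hg.mono hkn) hφ (Nat.lt_succ_self _)).2 hgk

/-- A decidable smooth theory with a computable minimal model function can be combined with a
decidable and infinitely decidable theory. -/
theorem DecidableTheory.combine (hdec₁ : DecidableTheory c.left T₁)
    (hdec₂ : DecidableTheory c.right T₂) (hsmooth : Smooth T₁)
    (hminmod : HasComputableMinimalModelFunction c.left T₁)
    (hinf : InfinitelyDecidable c.right T₂) :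
    DecidableTheory c (TheoryCombination.combine T₁ T₂) := by
  classical
  change ComputablePred (HasCode c (IsSat (TheoryCombination.combine T₁ T₂)))
  -- If one theory has no non-empty model, nothing is satisfiable in the union. Otherwise both
  -- theories can be queried for arities.
  by_cases hT : (∃ (M : Type) (_ : L₁.Structure M), Nonempty M ∧ M ⊨ T₁) ∧
    ∃ (M : Type) (_ : L₂.Structure M), Nonempty M ∧ M ⊨ T₂
  swap
  · refine (ComputablePred.const False).of_eq fun k => iff_of_false id ?_
    rintro ⟨φ, -, -, M, _, x, hM, -⟩
    let := (LHom.sumInl : L₁ →ᴸ L₁.sum L₂).reduct M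
    let := (LHom.sumInr : L₂ →ᴸ L₁.sum L₂).reduct M
    have := model_combine_iff.1 hM
    exact hT ⟨⟨M, _, ⟨x 0⟩, this.1⟩, M, _, ⟨x 0⟩, this.2⟩
  have har₁ := hdec₁.decidableArities hT.1
  have har₂ := hdec₂.decidableArities hT.2
  have hqf := computablePred_isQFCode (har₁.sum har₂)
  replace hdec₁ : ComputablePred (HasCode c.left (IsSat T₁)) := hdec₁
  replace hdec₂ : ComputablePred (HasCode c.right (IsSat T₂)) := hdec₂
  replace hinf : ComputablePred (HasCode c.right (IsInfinitelySat T₂)) := hinf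
  obtain ⟨minmod, hmin, f, hf, hfmin⟩ := hminmod
  obtain ⟨h, hcomp, hh⟩ : ∃ h : ℕ → Option ℕ, Computable h ∧
      ∀ φ : L₁.Formula ℕ, φ.IsQF → IsSat T₁ φ →
        minmod φ = (h (formulaCode c.left φ)).elim ⊤ fun k : ℕ => (k : ℕ∞) := by
    -- The given algorithm may diverge off the codes of quantifier-free formulas. Running it only on
    -- satisfiable codes makes it total.
    have hp := Partrec.cond hdec₁.decide hf (Computable.const (none : Option ℕ)).partrec
    have hdom (k : ℕ) : (cond (decide (HasCode c.left (IsSat T₁) k)) (f k)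
        (Part.some (none : Option ℕ))).Dom := by
      by_cases hk : HasCode c.left (IsSat T₁) k
      · obtain ⟨φ, hφ, rfl, -⟩ := id hk
        obtain ⟨o, ho, -⟩ := hfmin φ hφ
        simpa [hk] using ho.fst
      · simp [hk]
    refine ⟨fun k => Part.get _ (hdom k), hp.of_eq_tot fun k => Part.get_mem _,
      fun φ hφ hsat => ?_⟩
    obtain ⟨o, ho, hm⟩ := hfmin φ hφ
    have hk := (hasCode_formulaCode c.left hφ).2 hsat
    simp only [hk, decide_true, cond_true]
    rw [hm, Part.get_eq_of_mem ho]
  let n (k : ℕ) : ℕ := mkEq k k + 1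
  have hn : Computable n := Computable.succ.comp (computable_mkEq Computable.id Computable.id)
  have hg : Computable fun x : ℕ × ℕ => x.2 := Computable.snd
  have hn' : Computable fun x : ℕ × ℕ => n x.1 := hn.comp Computable.fst
  have hd₁ := computable_diagram har₁ hg hn'
  have hd₂ := computable_diagram har₂ hg hn'
  have ho := hcomp.comp hd₁
  have hnone : ComputablePred fun x : ℕ × ℕ => h (diagram c.left x.2 (n x.1)) = none :=
    ComputablePred.eq ho (Computable.const none)
  -- The default `0` of `getD` is harmless: that disjunct already requires a finite minimum.
  refine (hqf.and (ComputablePred.exists_lt (p := fun k g =>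
    RespectsConnectives (fun q => g.testBit q = true) (n k) ∧ g.testBit k = true ∧
    HasCode c.left (IsSat T₁) (diagram c.left g (n k)) ∧
      ((h (diagram c.left g (n k)) = none ∧
        HasCode c.right (IsInfinitelySat T₂) (diagram c.right g (n k))) ∨
      (h (diagram c.left g (n k)) ≠ none ∧ HasCode c.right (IsSat T₂) (mkAnd
        (diagram c.right g (n k)) (mkDistinct (n k) ((h (diagram c.left g (n k))).getD 0))))))
    hn.two_pow ((computablePred_respectsConnectives hg hn').and
      ((ComputablePred.testBit hg Computable.fst).and ((hdec₁.comp hd₁).and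
        ((hnone.and (hinf.comp hd₂)).or (hnone.not.and (hdec₂.comp (computable_mkAnd hd₂
          (computable_mkDistinct hn' (Computable.option_getD ho (Computable.const 0)))))))))))).of_eq
            fun k => ?_
  have hiff (g : ℕ) := exists_same_card_iff (T₂ := T₂) hsmooth hmin hh (represents_diagram c.left g (n k))
    (represents_diagram c.right g (n k)) (n := n k) fun M _ x y hxy hx =>
      hx.congr hxy fun _ _ => Iff.rfl
  simp only [← hiff]
  constructor
  · rintro ⟨⟨φ, hφ, hk, -⟩, hsat⟩
    exact ⟨φ, hφ, hk, (isSat_combine_iff c T₁ T₂ hφ hk (Nat.lt_succ_self _)).2 hsat⟩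
  · rintro ⟨φ, hφ, hk, hsat⟩
    exact ⟨⟨φ, hφ, hk, trivial⟩, (isSat_combine_iff c T₁ T₂ hφ hk (Nat.lt_succ_self _)).1 hsat⟩

end Combination

end TheoryCombination

theorem mainTheorem11
    (L₁ : FirstOrder.Language.{u₁, v₁}) (L₂ : FirstOrder.Language.{u₂, v₂})
    (c : TheoryCombination.Numbering (L₁.sum L₂))
    (T₁ : L₁.Theory) (T₂ : L₂.Theory)
    (hdec₁ : TheoryCombination.DecidableTheory c.left T₁)
    (hdec₂ : TheoryCombination.DecidableTheory c.right T₂)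
    (hsmooth : TheoryCombination.Smooth T₁)
    (hminmod : TheoryCombination.HasComputableMinimalModelFunction c.left T₁)
    (hinf : TheoryCombination.InfinitelyDecidable c.right T₂) :
    TheoryCombination.DecidableTheory c (TheoryCombination.combine T₁ T₂) :=
  TheoryCombination.DecidableTheory.combine hdec₁ hdec₂ hsmooth hminmod hinf
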